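/- Let $d\in\mathbb N$. Let $\dot W^1_1(\mathbb R^d)$ be the space of complex-valued distributions $f\in\mathscr D'(\mathbb R^d)$ with $\partial_j f\in L^1(\mathbb R^d)$ for $j=1,\dots,d$, modulo constants, with norm $\sum_{j=1}^d\|\partial_j f\|_{L^1(\mathbb R^d)}$. A function $m\in L^\infty(\mathbb R^d)$ (complex-valued) is called a Fourier multiplier on $\dot W^1_1(\mathbb R^d)$ with corresponding operator $T$ if $T:\dot W^1_1(\mathbb R^d)\to\dot W^1_1(\mathbb R^d)$ is a bounded linear operator such that $\widehat{Tf}=m\hat f$ for every Schwartz function $f\in\mathscr S(\mathbb R^d)$, i.e. the class $Tf$ has a tempered representative whose Fourier transform is $m\hat f$; it is called a Fourier multiplier on $\dot W^1_1(\mathbb R^d)$ if such a $T$ exists. Let $(m_k)_{k\in\mathbb N}$ be a sequence of Fourier multipliers on $\dot W^1_1(\mathbb R^d)$ with corresponding operators $T_k$, and suppose that $\sup_k\|T_k\|<\infty$. Let $m:\mathbb R^d\to\mathbb C$ be such that $m_k(\xi)\to m(\xi)$ for every $\xi\in\mathbb R^d$, and suppose that $\xi\mapsto m(\xi)\,\xi_j$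 is continuous on $\mathbb R^d$ for each $j\in\{1,\dots,d\}$. Then $m$ is a Fourier multiplier on $\dot W^1_1(\mathbb R^d)$ (in particular $m\in L^\infty(\mathbb R^d)$). -/

import Mathlib

noncomputable section

open MeasureTheory TopologicalSpace
open scoped Distributions SchwartzMap FourierTransform LineDeriv ENNReal ContDiff

namespace HomSobolev

/-- The Euclidean space `ℝ^d`. -/
abbrev Rd (d : ℕ) : Type := EuclideanSpace ℝ (Fin d)

/-- Complex-valued distributions on `ℝ^d`, i.e. the space `𝓓'(ℝ^d)`. -/
abbrev Distr (d : ℕ) : Type := 𝓓'((⊤ : Opens (Rd d)), ℂ)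

/-- The distribution `φ ↦ ∫ φ g` given by a locally integrable function `g`. -/
def ofFun {d : ℕ} (g : Rd d → ℂ) : Distr d :=
  TestFunction.integralAgainstBilinCLM (ContinuousLinearMap.lsmul ℝ ℝ) volume g

theorem ofFun_apply {d : ℕ} {g : Rd d → ℂ} (hg : LocallyIntegrable g)
    (φ : 𝓓((⊤ : Opens (Rd d)), ℝ)) : ofFun g φ = ∫ x, φ x • g x := by
  have h : LocallyIntegrableOn g ((⊤ : Opens (Rd d)) : Set (Rd d)) volume :=
    hg.locallyIntegrableOn _
  exact TestFunction.integralAgainstBilinCLM_eq_integral h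

theorem integrable_smul {d : ℕ} {g : Rd d → ℂ} (hg : LocallyIntegrable g)
    (φ : 𝓓((⊤ : Opens (Rd d)), ℝ)) : Integrable (fun x => φ x • g x) :=
  hg.integrable_smul_left_of_hasCompactSupport φ.continuous φ.hasCompactSupport

theorem L1_locallyIntegrable {d : ℕ} (g : Rd d →₁[volume] ℂ) : LocallyIntegrable g :=
  (L1.integrable_coeFn g).locallyIntegrable

/-- The inclusion of `L¹(ℝ^d)` into the distributions. -/
def ofL1 (d : ℕ) : (Rd d →₁[volume] ℂ) →ₗ[ℂ] Distr d where
  toFun g := ofFun g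
  map_add' f g := by
    ext φ
    change ofFun _ φ = ofFun _ φ + ofFun _ φ
    rw [ofFun_apply (L1_locallyIntegrable _), ofFun_apply (L1_locallyIntegrable _),
      ofFun_apply (L1_locallyIntegrable _), ← integral_add
        (integrable_smul (L1_locallyIntegrable f) φ) (integrable_smul (L1_locallyIntegrable g) φ)]
    refine integral_congr_ae ?_
    filter_upwards [Lp.coeFn_add f g] with x hx
    rw [hx, Pi.add_apply, smul_add]
  map_smul' c f := by
    ext φ
    change ofFun _ φ = c • ofFun _ φ
    rw [ofFun_apply (L1_locallyIntegrable _), ofFun_apply (L1_locallyIntegrable _),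
      ← integral_smul]
    refine integral_congr_ae ?_
    filter_upwards [Lp.coeFn_smul c f] with x hx
    simp [hx, mul_left_comm]

theorem ofL1_injective (d : ℕ) : Function.Injective (ofL1 d) := by
  intro f g hfg
  refine Lp.ext ?_
  refine ae_eq_of_integral_contDiff_smul_eq (L1_locallyIntegrable f) (L1_locallyIntegrable g) ?_
  intro φ hφ hc
  let ψ : 𝓓((⊤ : Opens (Rd d)), ℝ) := ⟨φ, hφ, hc, fun _ _ => trivial⟩
  have h : ofFun f ψ = ofFun g ψ := congrArg (fun u : Distr d => u ψ) hfg
  rw [ofFun_apply (L1_locallyIntegrable _), ofFun_apply (L1_locallyIntegrable _)] at h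
  exact h

/-- The distributional partial derivative `∂_j`, as a complex linear map on `𝓓'(ℝ^d)`. -/
def pderiv {d : ℕ} (j : Fin d) : Distr d →ₗ[ℂ] Distr d where
  toFun u := ∂_{EuclideanSpace.single j (1 : ℝ)} u
  map_add' u v := LineDeriv.lineDerivOp_add _ u v
  map_smul' c u := by
    ext φ
    change (∂_{EuclideanSpace.single j (1 : ℝ)} (c • u)) φ
      = c • (∂_{EuclideanSpace.single j (1 : ℝ)} u) φ
    rw [Distribution.lineDerivOp_apply_apply, Distribution.lineDerivOp_apply_apply]
    rfl

/-- The distributions on `ℝ^d` all of whose first order partial derivatives lie in `L¹(ℝ^d)`. -/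
def w11 (d : ℕ) : Submodule ℂ (Distr d) :=
  ⨅ j : Fin d, (LinearMap.range (ofL1 d)).comap (pderiv j)

/-- The homogeneous Sobolev space before passing to the quotient by the constants. It is a separate
type, so that it carries the topology of its seminorm and not the one of `𝓓'(ℝ^d)`. -/
def PreW11 (d : ℕ) : Type := w11 d

instance (d : ℕ) : AddCommGroup (PreW11 d) := inferInstanceAs (AddCommGroup (w11 d))

instance (d : ℕ) : Module ℂ (PreW11 d) := inferInstanceAs (Module ℂ (w11 d))

/-- The inclusion of the homogeneous Sobolev space into the distributions. -/
def PreW11.toDistr (d : ℕ) : PreW11 d →ₗ[ℂ] Distr d := (w11 d).subtype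

theorem PreW11.pderiv_mem {d : ℕ} (j : Fin d) (u : PreW11 d) :
    pderiv j (PreW11.toDistr d u) ∈ LinearMap.range (ofL1 d) :=
  (Submodule.mem_iInf _).1 u.2 j

/-- The partial derivative `∂_j u` as an element of `L¹(ℝ^d)`. -/
def PreW11.grad {d : ℕ} (j : Fin d) : PreW11 d →ₗ[ℂ] (Rd d →₁[volume] ℂ) :=
  (LinearEquiv.ofInjective (ofL1 d) (ofL1_injective d)).symm.toLinearMap ∘ₗ
    ((pderiv j ∘ₗ PreW11.toDistr d).codRestrict (LinearMap.range (ofL1 d))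
      (PreW11.pderiv_mem j))

theorem PreW11.ofL1_grad {d : ℕ} (j : Fin d) (u : PreW11 d) :
    ofL1 d (PreW11.grad j u) = pderiv j (PreW11.toDistr d u) :=
  congrArg Subtype.val (LinearEquiv.apply_symm_apply
    (LinearEquiv.ofInjective (ofL1 d) (ofL1_injective d)) ⟨_, PreW11.pderiv_mem j u⟩)

/-- The seminorm `∑ j, ‖∂_j u‖_{L¹}`. -/
def PreW11.seminorm (d : ℕ) : Seminorm ℂ (PreW11 d) :=
  ∑ j : Fin d, (normSeminorm ℂ (Rd d →₁[volume] ℂ)).comp (PreW11.grad j)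

instance (d : ℕ) : SeminormedAddCommGroup (PreW11 d) :=
  (PreW11.seminorm d).toAddGroupSeminorm.toSeminormedAddCommGroup

theorem PreW11.norm_def {d : ℕ} (u : PreW11 d) : ‖u‖ = ∑ j : Fin d, ‖PreW11.grad j u‖ := by
  change PreW11.seminorm d u = _
  simp [PreW11.seminorm]

instance (d : ℕ) : NormedSpace ℂ (PreW11 d) where
  norm_smul_le c u := (map_smul_eq_mul (PreW11.seminorm d) c u).le

/-- The constant functions in the homogeneous Sobolev space (polynomials of degree `< 1`). -/
def constants (d : ℕ) : Submodule ℂ (PreW11 d) :=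
  (Submodule.span ℂ {ofFun (fun _ : Rd d => (1 : ℂ))}).comap (PreW11.toDistr d)

/-- The homogeneous Sobolev space `Ẇ¹₁(ℝ^d)`: distributions with integrable first order derivatives
modulo constants, with the quotient norm. -/
abbrev W11 (d : ℕ) : Type := PreW11 d ⧸ constants d

theorem schwartz_mem {d : ℕ} (f : 𝓢(Rd d, ℂ)) : ofFun f ∈ w11 d := by
  refine (Submodule.mem_iInf _).2 fun j => ?_
  set v : Rd d := EuclideanSpace.single j (1 : ℝ) with hv
  have hf : LocallyIntegrable f := f.integrable.locallyIntegrable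
  have hD : Integrable (∂_{v} f : 𝓢(Rd d, ℂ)) := (∂_{v} f : 𝓢(Rd d, ℂ)).integrable
  refine ⟨hD.toL1 _, ?_⟩
  ext φ
  change ofFun _ φ = (∂_{v} (ofFun f)) φ
  rw [Distribution.lineDerivOp_apply_apply, map_neg, ofFun_apply (L1_locallyIntegrable _),
    ofFun_apply hf]
  have h1 : ∫ x, φ x • (hD.toL1 _ : Rd d →₁[volume] ℂ) x = ∫ x, φ x • fderiv ℝ f x v := by
    refine integral_congr_ae ?_
    filter_upwards [hD.coeFn_toL1] with x hx
    rw [hx, SchwartzMap.lineDerivOp_apply_eq_fderiv]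
  have h2 : ∀ x, (∂_{v} φ : 𝓓((⊤ : Opens (Rd d)), ℝ)) x = fderiv ℝ φ x v := by
    intro x
    rw [TestFunction.lineDerivOp_eq_lineDerivCLM ℝ, TestFunction.lineDerivCLM_apply_of_le]
    · exact (φ.contDiff.differentiable (by simp) x).lineDeriv_eq_fderiv
    · simp
  rw [h1]
  simp_rw [h2]
  refine integral_smul_fderiv_eq_neg_fderiv_smul_of_integrable ?_ ?_ ?_ ?_ ?_
  · have := integrable_smul hf (∂_{v} φ)
    simpa only [h2] using this
  · have := integrable_smul hD.locallyIntegrable φ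
    simpa only [SchwartzMap.lineDerivOp_apply_eq_fderiv] using this
  · exact integrable_smul hf φ
  · exact fun x _ => φ.contDiff.differentiable (by simp) x
  · exact fun x _ => f.differentiable x

/-- The class in `Ẇ¹₁(ℝ^d)` of a Schwartz function. -/
def ofSchwartz {d : ℕ} (f : 𝓢(Rd d, ℂ)) : W11 d :=
  Submodule.Quotient.mk (⟨ofFun f, schwartz_mem f⟩ : PreW11 d)

/-- A real test function, regarded as a complex-valued Schwartz function. -/
def testToSchwartz {d : ℕ} (φ : 𝓓((⊤ : Opens (Rd d)), ℝ)) : 𝓢(Rd d, ℂ) :=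
  (φ.hasCompactSupport.comp_left (g := Complex.ofRealCLM) rfl).toSchwartzMap
    (Complex.ofRealCLM.contDiff.comp φ.contDiff)

/-- The tempered distribution `v` restricts to the distribution `u`. -/
def IsRestriction {d : ℕ} (u : Distr d) (v : 𝓢'(Rd d, ℂ)) : Prop :=
  ∀ φ : 𝓓((⊤ : Opens (Rd d)), ℝ), u φ = v (testToSchwartz φ)

/-- The tempered distribution `v` is given by the function `g`. -/
def IsGivenBy {d : ℕ} (v : 𝓢'(Rd d, ℂ)) (g : Rd d → ℂ) : Prop :=
  ∀ φ : 𝓢(Rd d, ℂ), Integrable (fun ξ => φ ξ * g ξ) ∧ v φ = ∫ ξ, φ ξ * g ξ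

/-- `m ∈ L^∞(ℝ^d)` is a Fourier multiplier on `Ẇ¹₁(ℝ^d)` with corresponding bounded operator `T`:
the Fourier transform of `T f` is `m` times the Fourier transform of `f`, for all Schwartz
functions `f`. As `T f` is a class modulo constants, this is the requirement that one of its
representatives is a tempered distribution with Fourier transform `m * 𝓕 f`. -/
def IsMultiplierWith {d : ℕ} (m : Rd d → ℂ) (T : W11 d →L[ℂ] W11 d) : Prop :=
  MemLp m (⊤ : ℝ≥0∞) volume ∧
    ∀ f : 𝓢(Rd d, ℂ), ∃ (u : PreW11 d) (v : 𝓢'(Rd d, ℂ)),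
      T (ofSchwartz f) = Submodule.Quotient.mk u ∧ IsRestriction (PreW11.toDistr d u) v ∧
        IsGivenBy (𝓕 v) (fun ξ => m ξ * 𝓕 f ξ)

/-- `m` is a Fourier multiplier on `Ẇ¹₁(ℝ^d)`. -/
def IsMultiplier {d : ℕ} (m : Rd d → ℂ) : Prop :=
  ∃ T : W11 d →L[ℂ] W11 d, IsMultiplierWith m T

end HomSobolev

end

noncomputable section

open MeasureTheory TopologicalSpace Filter
open scoped Distributions SchwartzMap FourierTransform LineDeriv ENNReal ContDiff Topology

namespace HomSobolev

variable {d : ℕ}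

/-! Everything is done on the gradient side, where classes modulo constants become honest tuples of
`L¹` functions.

A multiplier is controlled in `L^∞` by the norm of its operator. Test the operator on `f(r·)`, where
the Fourier transform of `f` equals `1` near the origin. The `L¹` Fourier bound for the derivatives
of the image controls `m` on the annulus `r ≤ ‖ξ‖ ≤ 2r`, and by scaling the constant does not depend
on `r` (`IsMultiplierWith.ae_norm_le_const`). Hence the `m k` are uniformly bounded. For a Schwartz
function `f`, dominated convergence gives `𝓕⁻ (m k * 𝓕 (∂_j f)) → 𝓕⁻ (m₀ * 𝓕 (∂_j f))` pointwise,
and Fatou's lemma transfers the uniform `L¹` bounds to the limit (`exists_limit_grad`). The result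
is a linear map `B` from Schwartz functions to curl-free `L¹` tuples, bounded in terms of the
gradient of `f` (`exists_limit_operator`).

To extend `B` to the whole space, two facts about curl-free `L¹` fields are needed. First, those
with vanishing integrals are limits of gradients of Schwartz functions
(`mem_closure_range_schwartzGrad`). The vanishing integrals can fail for `d = 1`, but they are
finitely many conditions, so the mean-zero fields have a bounded projection onto them and the
extension by density can be composed with it (`exists_continuous_extension`). Second, the gradient
has a bounded right inverse modulo constants, given by division by `2πi ξ` on the Fourier side
(`potentialW`). The operator is then: gradient, extended `B`, potential. On Schwartz functions its
value differs from `𝓕⁻ (m₀ * 𝓕 f)` by a constant only (`potential_eq_sub`). Dimension zero is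
treated separately. -/

/-! ### Fourier pairings, derivatives and tempered representatives. -/

/-- The `j`-th vector of the standard basis of `ℝ^d`. -/
abbrev stdVec (j : Fin d) : Rd d := EuclideanSpace.single j (1 : ℝ)

/-- The Fourier symbol `2πi ξ_j` of the partial derivative `∂_j`. -/
def derivSymbol (j : Fin d) (ξ : Rd d) : ℂ := 2 * Real.pi * Complex.I * (ξ j : ℝ)

theorem continuous_derivSymbol (j : Fin d) : Continuous (derivSymbol j) := by
  unfold derivSymbol
  fun_prop

theorem norm_derivSymbol (j : Fin d) (ξ : Rd d) : ‖derivSymbol j ξ‖ = 2 * Real.pi * |ξ j| := by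
  simp [derivSymbol, abs_of_pos Real.pi_pos]

theorem continuous_fourier {g : Rd d → ℂ} (hg : Integrable g) : Continuous (𝓕 g) :=
  VectorFourier.fourierIntegral_continuous Real.continuous_fourierChar
    (by exact continuous_inner) hg

theorem continuous_fourierInv {g : Rd d → ℂ} (hg : Integrable g) : Continuous (𝓕⁻ g) := by
  have : 𝓕⁻ g = fun x => 𝓕 g (-x) := funext fun x => Real.fourierInv_eq_fourier_neg g x
  rw [this]
  exact (continuous_fourier hg).comp continuous_neg

theorem norm_fourier_le (g : Rd d → ℂ) (ξ : Rd d) : ‖𝓕 g ξ‖ ≤ ∫ x, ‖g x‖ :=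
  VectorFourier.norm_fourierIntegral_le_integral_norm _ _ _ g ξ

theorem integral_fourier_mul {f g : Rd d → ℂ} (hf : Integrable f) (hg : Integrable g) :
    ∫ ξ, 𝓕 f ξ * g ξ = ∫ x, f x * 𝓕 g x := by
  have := VectorFourier.integral_fourierIntegral_smul_eq_flip (L := innerₗ (Rd d))
    (μ := volume) (ν := volume) Real.continuous_fourierChar continuous_inner hf hg
  rw [flip_innerₗ] at this
  exact this

theorem integral_fourierInv_mul {f g : Rd d → ℂ} (hf : Integrable f) (hg : Integrable g) :
    ∫ ξ, 𝓕⁻ f ξ * g ξ = ∫ x, f x * 𝓕⁻ g x := by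
  have h1 : ∫ ξ, 𝓕⁻ f ξ * g ξ = ∫ ξ, 𝓕 f ξ * g (-ξ) := by
    rw [← integral_neg_eq_self]
    simp [Real.fourierInv_eq_fourier_neg]
  rw [h1, integral_fourier_mul hf hg.comp_neg]
  congr with x
  rw [Real.fourierInv_eq_fourier_comp_neg]

theorem fourier_lineDerivOp_apply (φ : 𝓢(Rd d, ℂ)) (j : Fin d) (ξ : Rd d) :
    𝓕 (∂_{stdVec j} φ : 𝓢(Rd d, ℂ)) ξ = derivSymbol j ξ * 𝓕 φ ξ := by
  have : (fun x : Rd d => inner ℝ x (stdVec j)).HasTemperateGrowth := by fun_prop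
  rw [SchwartzMap.fourier_lineDerivOp_eq, smul_apply,
    SchwartzMap.smulLeftCLM_apply_apply this]
  simp [derivSymbol, EuclideanSpace.inner_single_right, mul_assoc]

theorem fourierInv_lineDerivOp_apply (φ : 𝓢(Rd d, ℂ)) (j : Fin d) (ξ : Rd d) :
    𝓕⁻ (∂_{stdVec j} φ : 𝓢(Rd d, ℂ)) ξ = -(derivSymbol j ξ * 𝓕⁻ φ ξ) := by
  have : (fun x : Rd d => inner ℝ x (stdVec j)).HasTemperateGrowth := by fun_prop
  rw [SchwartzMap.fourierInv_lineDerivOp_eq, smul_apply,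
    SchwartzMap.smulLeftCLM_apply_apply this]
  simp [derivSymbol, EuclideanSpace.inner_single_right, mul_assoc]

theorem testToSchwartz_apply (φ : 𝓓((⊤ : Opens (Rd d)), ℝ)) (x : Rd d) :
    testToSchwartz φ x = (φ x : ℂ) := rfl

theorem lineDerivOp_testFunction_apply (φ : 𝓓((⊤ : Opens (Rd d)), ℝ)) (v x : Rd d) :
    (∂_{v} φ : 𝓓((⊤ : Opens (Rd d)), ℝ)) x = fderiv ℝ φ x v := by
  rw [TestFunction.lineDerivOp_eq_lineDerivCLM ℝ, TestFunction.lineDerivCLM_apply_of_le]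
  · exact (φ.contDiff.differentiable (by simp) x).lineDeriv_eq_fderiv
  · simp

theorem testToSchwartz_lineDerivOp (φ : 𝓓((⊤ : Opens (Rd d)), ℝ)) (v : Rd d) :
    testToSchwartz (∂_{v} φ) = ∂_{v} (testToSchwartz φ) := by
  ext x
  rw [testToSchwartz_apply, lineDerivOp_testFunction_apply,
    SchwartzMap.lineDerivOp_apply_eq_fderiv]
  have h : HasFDerivAt (testToSchwartz φ) (Complex.ofRealCLM.comp (fderiv ℝ φ x)) x :=
    Complex.ofRealCLM.hasFDerivAt.comp x
      (φ.contDiff.differentiable (by simp) x).hasFDerivAt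
  rw [h.fderiv]
  rfl

theorem ofFun_apply_eq_integral_mul {g : Rd d → ℂ} (hg : LocallyIntegrable g)
    (φ : 𝓓((⊤ : Opens (Rd d)), ℝ)) : ofFun g φ = ∫ x, testToSchwartz φ x * g x := by
  rw [ofFun_apply hg]
  rfl

theorem ofFun_fourierInv_apply {g : Rd d → ℂ} (hg : Integrable g)
    (φ : 𝓓((⊤ : Opens (Rd d)), ℝ)) :
    ofFun (𝓕⁻ g) φ = ∫ ξ, 𝓕⁻ (testToSchwartz φ) ξ * g ξ := by
  rw [ofFun_apply_eq_integral_mul (continuous_fourierInv hg).locallyIntegrable,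
    ← integral_fourierInv_mul (testToSchwartz φ).integrable hg, SchwartzMap.fourierInv_coe]

theorem pderiv_apply (j : Fin d) (u : Distr d) (φ : 𝓓((⊤ : Opens (Rd d)), ℝ)) :
    pderiv j u φ = -u (∂_{stdVec j} φ) := by
  change (∂_{stdVec j} u) φ = _
  rw [Distribution.lineDerivOp_apply_apply, map_neg]

theorem pderiv_ofFun_fourierInv (j : Fin d) {g : Rd d → ℂ} (hg : Integrable g)
    (hg' : Integrable fun ξ => derivSymbol j ξ * g ξ) :
    pderiv j (ofFun (𝓕⁻ g)) = ofFun (𝓕⁻ fun ξ => derivSymbol j ξ * g ξ) := by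
  ext φ
  rw [pderiv_apply, ofFun_fourierInv_apply hg, ofFun_fourierInv_apply hg',
    testToSchwartz_lineDerivOp, ← integral_neg]
  congr with ξ
  rw [fourierInv_lineDerivOp_apply]
  ring

theorem ae_eq_of_ofFun_eq {f g : Rd d → ℂ} (hf : LocallyIntegrable f) (hg : LocallyIntegrable g)
    (h : ofFun f = ofFun g) : f =ᵐ[volume] g := by
  refine ae_eq_of_integral_contDiff_smul_eq hf hg fun φ hφ hc => ?_
  have := congrArg (fun u : Distr d => u ⟨φ, hφ, hc, fun _ _ => trivial⟩) h
  rwa [ofFun_apply hf, ofFun_apply hg] at this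

theorem ae_eq_of_integral_schwartz_eq {f g : Rd d → ℂ} (hf : LocallyIntegrable f)
    (hg : LocallyIntegrable g) (h : ∀ φ : 𝓢(Rd d, ℂ), ∫ x, φ x * f x = ∫ x, φ x * g x) :
    f =ᵐ[volume] g := by
  refine ae_eq_of_ofFun_eq hf hg ?_
  ext φ
  rw [ofFun_apply_eq_integral_mul hf, ofFun_apply_eq_integral_mul hg, h]

theorem fourier_ae_eq_of_ae_eq_fourierInv {h g : Rd d → ℂ} (hh : Integrable h) (hg : Integrable g)
    (e : h =ᵐ[volume] 𝓕⁻ g) : 𝓕 h =ᵐ[volume] g := by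
  refine ae_eq_of_integral_schwartz_eq (continuous_fourier hh).locallyIntegrable
    hg.locallyIntegrable fun φ => ?_
  rw [← integral_fourier_mul φ.integrable hh]
  have h1 : ∫ ξ, 𝓕 (φ : Rd d → ℂ) ξ * h ξ = ∫ ξ, 𝓕 φ ξ * 𝓕⁻ g ξ := by
    refine integral_congr_ae ?_
    filter_upwards [e] with x hx
    rw [hx, SchwartzMap.fourier_coe]
  rw [h1, ← integral_fourierInv_mul (𝓕 φ).integrable hg, ← SchwartzMap.fourierInv_coe,
    FourierTransform.fourierInv_fourier_eq]

theorem ae_eq_of_fourier_eq {f g : Rd d → ℂ} (hf : Integrable f) (hg : Integrable g)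
    (h : 𝓕 f = 𝓕 g) : f =ᵐ[volume] g := by
  refine ae_eq_of_integral_schwartz_eq hf.locallyIntegrable hg.locallyIntegrable fun φ => ?_
  have key : ∀ {k : Rd d → ℂ}, Integrable k → ∫ x, φ x * k x = ∫ x, 𝓕⁻ φ x * 𝓕 k x := by
    intro k hk
    rw [← integral_fourier_mul (𝓕⁻ φ).integrable hk, ← SchwartzMap.fourier_coe,
      FourierTransform.fourier_fourierInv_eq]
  rw [key hf, key hg, h]

theorem integrable_schwartz_mul {g : Rd d → ℂ} (hg : Integrable g) (φ : 𝓢(Rd d, ℂ)) :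
    Integrable fun ξ => φ ξ * g ξ := by
  refine hg.bdd_mul (c := SchwartzMap.seminorm ℝ 0 0 φ) φ.continuous.aestronglyMeasurable ?_
  exact ae_of_all _ fun x => SchwartzMap.norm_le_seminorm ℝ φ x

/-- Makes the representative in `IsMultiplierWith` explicit: since its Fourier transform is
integrable, it is a continuous function whose derivatives can be computed under the Fourier
integral. -/
theorem eq_ofFun_fourierInv_of_isRestriction {u : Distr d} {v : 𝓢'(Rd d, ℂ)} {g : Rd d → ℂ}
    (hg : Integrable g) (huv : IsRestriction u v) (hv : IsGivenBy (𝓕 v) g) :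
    u = ofFun (𝓕⁻ g) := by
  ext φ
  rw [ofFun_fourierInv_apply hg, huv φ, ← (hv (𝓕⁻ (testToSchwartz φ))).2,
    TemperedDistribution.fourier_apply, FourierTransform.fourier_fourierInv_eq]

theorem exists_isRestriction_isGivenBy {g : Rd d → ℂ} (hg : Integrable g) :
    ∃ v : 𝓢'(Rd d, ℂ), IsRestriction (ofFun (𝓕⁻ g)) v ∧ IsGivenBy (𝓕 v) g := by
  have key : ∀ φ : 𝓢(Rd d, ℂ), Lp.toTemperedDistribution (hg.toL1 g) φ = ∫ ξ, φ ξ * g ξ := by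
    intro φ
    rw [Lp.toTemperedDistribution_apply]
    refine integral_congr_ae ?_
    filter_upwards [hg.coeFn_toL1] with x hx
    rw [hx, smul_eq_mul]
  refine ⟨𝓕⁻ (Lp.toTemperedDistribution (hg.toL1 g)), fun φ => ?_, fun φ => ?_⟩
  · rw [TemperedDistribution.fourierInv_apply, key, ofFun_fourierInv_apply hg]
  · rw [FourierTransform.fourier_fourierInv_eq]
    exact ⟨integrable_schwartz_mul hg φ, key φ⟩

/-! ### The gradient on the quotient by constants. -/

theorem fourier_zero (g : Rd d → ℂ) : 𝓕 g 0 = ∫ x, g x := by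
  simp [Real.fourier_eq]

theorem integral_lineDerivOp (φ : 𝓢(Rd d, ℂ)) (j : Fin d) :
    ∫ x, (∂_{stdVec j} φ : 𝓢(Rd d, ℂ)) x = 0 := by
  rw [← fourier_zero, ← SchwartzMap.fourier_coe, fourier_lineDerivOp_apply]
  simp [derivSymbol]

theorem pderiv_ofFun_one (j : Fin d) : pderiv j (ofFun fun _ : Rd d => (1 : ℂ)) = 0 := by
  ext φ
  rw [pderiv_apply, ofFun_apply_eq_integral_mul continuous_const.locallyIntegrable,
    testToSchwartz_lineDerivOp]
  simp [integral_lineDerivOp]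

theorem grad_eq_zero_of_mem_constants (j : Fin d) {c : PreW11 d} (hc : c ∈ constants d) :
    PreW11.grad j c = 0 := by
  apply ofL1_injective d
  obtain ⟨a, ha⟩ := Submodule.mem_span_singleton.1 (Submodule.mem_comap.1 hc)
  rw [PreW11.ofL1_grad, ← ha, map_zero]
  exact LinearMap.mem_ker.1
    ((LinearMap.ker (pderiv j)).smul_mem a (LinearMap.mem_ker.2 (pderiv_ofFun_one j)))

/-- The partial derivative `∂_j` on the homogeneous Sobolev space. -/
def gradW (j : Fin d) : W11 d →L[ℂ] (Rd d →₁[volume] ℂ) :=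
  ((constants d).liftQ (PreW11.grad j) fun _ hc => grad_eq_zero_of_mem_constants j hc).mkContinuous
    1 fun q => by
      refine le_of_forall_pos_le_add fun ε hε => ?_
      obtain ⟨u, rfl, hu⟩ := Submodule.Quotient.norm_mk_lt q hε
      rw [one_mul]
      refine le_trans ?_ hu.le
      rw [PreW11.norm_def]
      exact Finset.single_le_sum (f := fun i => ‖PreW11.grad i u‖)
        (fun i _ => norm_nonneg _) (Finset.mem_univ j)

theorem gradW_mk (j : Fin d) (u : PreW11 d) :
    gradW j (Submodule.Quotient.mk u) = PreW11.grad j u := rfl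

theorem norm_gradW_le (j : Fin d) (q : W11 d) : ‖gradW j q‖ ≤ ‖q‖ := by
  simpa using (gradW j).le_of_opNorm_le (LinearMap.mkContinuous_norm_le _ zero_le_one _) q

theorem grad_ae_eq (j : Fin d) {u : PreW11 d} {g : Rd d → ℂ} (hg : Integrable g)
    (hg' : Integrable fun ξ => derivSymbol j ξ * g ξ)
    (hu : PreW11.toDistr d u = ofFun (𝓕⁻ g)) :
    PreW11.grad j u =ᵐ[volume] 𝓕⁻ fun ξ => derivSymbol j ξ * g ξ := by
  refine ae_eq_of_ofFun_eq (L1_locallyIntegrable _)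
    (continuous_fourierInv hg').locallyIntegrable ?_
  rw [← pderiv_ofFun_fourierInv j hg hg', ← hu, ← PreW11.ofL1_grad]
  rfl

/-- The gradient of a Schwartz function, as a tuple of integrable functions. -/
def schwartzGrad (d : ℕ) : 𝓢(Rd d, ℂ) →ₗ[ℂ] (Fin d → (Rd d →₁[volume] ℂ)) :=
  LinearMap.pi fun j => (SchwartzMap.toLpCLM ℂ ℂ 1 volume).toLinearMap ∘ₗ
    (LineDeriv.lineDerivOpCLM ℂ 𝓢(Rd d, ℂ) (stdVec j)).toLinearMap

theorem schwartzGrad_apply (f : 𝓢(Rd d, ℂ)) (j : Fin d) :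
    schwartzGrad d f j = (∂_{stdVec j} f : 𝓢(Rd d, ℂ)).toLp 1 := rfl

theorem derivSymbol_mul_mul_fourier (m : Rd d → ℂ) (f : 𝓢(Rd d, ℂ)) (j : Fin d) :
    (fun ξ => derivSymbol j ξ * (m ξ * 𝓕 f ξ)) =
      fun ξ => m ξ * 𝓕 (∂_{stdVec j} f : 𝓢(Rd d, ℂ)) ξ := by
  ext ξ
  rw [fourier_lineDerivOp_apply]
  ring

theorem integrable_mul_schwartz {m : Rd d → ℂ} (hm : MemLp m ∞ volume) (f : 𝓢(Rd d, ℂ)) :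
    Integrable fun ξ => m ξ * f ξ :=
  f.integrable.mul_of_top_right hm

/-- A Schwartz function as an element of the homogeneous Sobolev space. -/
def schwartzPre (f : 𝓢(Rd d, ℂ)) : PreW11 d := ⟨ofFun f, schwartz_mem f⟩

theorem toDistr_schwartzPre (f : 𝓢(Rd d, ℂ)) : PreW11.toDistr d (schwartzPre f) = ofFun f := rfl

theorem gradW_ofSchwartz (f : 𝓢(Rd d, ℂ)) (j : Fin d) :
    gradW j (ofSchwartz f) = schwartzGrad d f j := by
  rw [schwartzGrad_apply]
  refine Lp.ext ?_
  have hf : PreW11.toDistr d (schwartzPre f) =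
      ofFun (𝓕⁻ ((𝓕 f : 𝓢(Rd d, ℂ)) : Rd d → ℂ)) := by
    rw [← SchwartzMap.fourierInv_coe, FourierTransform.fourierInv_fourier_eq,
      toDistr_schwartzPre]
  have e : (fun ξ => derivSymbol j ξ * 𝓕 f ξ) = (𝓕 (∂_{stdVec j} f : 𝓢(Rd d, ℂ)) : 𝓢(Rd d, ℂ)) := by
    ext ξ
    rw [fourier_lineDerivOp_apply]
  have h := grad_ae_eq j (𝓕 f).integrable
    (by rw [e]; exact (𝓕 (∂_{stdVec j} f : 𝓢(Rd d, ℂ))).integrable) hf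
  rw [e, ← SchwartzMap.fourierInv_coe, FourierTransform.fourierInv_fourier_eq] at h
  exact h.trans (SchwartzMap.coeFn_toLp _ _ _).symm

theorem norm_ofSchwartz_le (f : 𝓢(Rd d, ℂ)) : ‖ofSchwartz f‖ ≤ d * ‖schwartzGrad d f‖ := by
  calc ‖ofSchwartz f‖ ≤ ‖schwartzPre f‖ :=
        Submodule.Quotient.norm_mk_le _ _
    _ = ∑ j : Fin d, ‖schwartzGrad d f j‖ := by
        rw [PreW11.norm_def]
        exact Finset.sum_congr rfl fun j _ => congrArg norm (gradW_ofSchwartz f j)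
    _ ≤ ∑ j : Fin d, ‖schwartzGrad d f‖ := Finset.sum_le_sum fun j _ => norm_le_pi_norm _ j
    _ = d * ‖schwartzGrad d f‖ := by simp

/-! ### The operator norm controls the supremum of the multiplier. -/

theorem IsMultiplierWith.exists_grad {m : Rd d → ℂ} {T : W11 d →L[ℂ] W11 d}
    (h : IsMultiplierWith m T) (f : 𝓢(Rd d, ℂ)) (j : Fin d) :
    ∃ g : Rd d →₁[volume] ℂ,
      (g =ᵐ[volume] 𝓕⁻ fun ξ => m ξ * 𝓕 (∂_{stdVec j} f : 𝓢(Rd d, ℂ)) ξ) ∧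
      ‖g‖ ≤ ‖T‖ * (d * ‖schwartzGrad d f‖) := by
  obtain ⟨u, v, hu, huv, hv⟩ := h.2 f
  have hg := integrable_mul_schwartz h.1 (𝓕 f)
  have hg' := integrable_mul_schwartz h.1 (𝓕 (∂_{stdVec j} f))
  rw [← derivSymbol_mul_mul_fourier] at hg' ⊢
  refine ⟨PreW11.grad j u,
    grad_ae_eq j hg hg' (eq_ofFun_fourierInv_of_isRestriction hg huv hv), ?_⟩
  calc ‖PreW11.grad j u‖ = ‖gradW j (T (ofSchwartz f))‖ := by rw [hu, gradW_mk]
    _ ≤ ‖T (ofSchwartz f)‖ := norm_gradW_le _ _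
    _ ≤ ‖T‖ * ‖ofSchwartz f‖ := T.le_opNorm _
    _ ≤ _ := by gcongr; exact norm_ofSchwartz_le f

theorem IsMultiplierWith.ae_norm_le {m : Rd d → ℂ} {T : W11 d →L[ℂ] W11 d}
    (h : IsMultiplierWith m T) (f : 𝓢(Rd d, ℂ)) (j : Fin d) :
    ∀ᵐ ξ, ‖m ξ * 𝓕 (∂_{stdVec j} f : 𝓢(Rd d, ℂ)) ξ‖ ≤ ‖T‖ * (d * ‖schwartzGrad d f‖) := by
  obtain ⟨g, hg, hle⟩ := h.exists_grad f j
  -- The product `m * 𝓕 (∂_j f)` is the Fourier transform of an `L¹` function, hence bounded by its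
  -- `L¹` norm.
  filter_upwards [fourier_ae_eq_of_ae_eq_fourierInv (L1.integrable_coeFn g)
    (integrable_mul_schwartz h.1 (𝓕 (∂_{stdVec j} f))) hg] with ξ hξ
  rw [← hξ]
  exact (norm_fourier_le _ ξ).trans ((L1.norm_eq_integral_norm g).symm.le.trans hle)

/-- The dilation `x ↦ f (r x)` of a Schwartz function. -/
def dilate {r : ℝ} (hr : r ≠ 0) : 𝓢(Rd d, ℂ) →L[ℂ] 𝓢(Rd d, ℂ) :=
  SchwartzMap.compCLMOfContinuousLinearEquiv ℂ
    (LinearEquiv.smulOfNeZero ℝ (Rd d) r hr).toContinuousLinearEquiv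

theorem dilate_apply {r : ℝ} (hr : r ≠ 0) (f : 𝓢(Rd d, ℂ)) (x : Rd d) :
    dilate hr f x = f (r • x) := rfl

theorem lineDerivOp_dilate {r : ℝ} (hr : r ≠ 0) (f : 𝓢(Rd d, ℂ)) (v : Rd d) :
    ∂_{v} (dilate hr f) = r • dilate hr (∂_{v} f) := by
  unfold dilate
  rw [SchwartzMap.lineDerivOp_compCLMOfContinuousLinearEquiv]
  have : (LinearEquiv.smulOfNeZero ℝ (Rd d) r hr).toContinuousLinearEquiv v = r • v := rfl
  rw [this, LineDeriv.lineDerivOp_left_smul]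
  ext x
  simp

theorem fourier_comp_smul {r : ℝ} (hr : 0 < r) (g : Rd d → ℂ) (ξ : Rd d) :
    𝓕 (fun x => g (r • x)) ξ = ((r ^ d)⁻¹ : ℝ) • 𝓕 g (r⁻¹ • ξ) := by
  rw [Real.fourier_eq, Real.fourier_eq]
  have := Measure.integral_comp_smul (volume : Measure (Rd d))
    (fun v => Real.fourierChar (-inner ℝ v (r⁻¹ • ξ)) • g v) r
  rw [finrank_euclideanSpace_fin, abs_of_pos (by positivity)] at this
  rw [← this]
  congr with x
  rw [inner_smul_left, inner_smul_right]
  simp [hr.ne']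

theorem norm_toLp_dilate {r : ℝ} (hr : 0 < r) (f : 𝓢(Rd d, ℂ)) :
    ‖(dilate hr.ne' f).toLp 1‖ = (r ^ d)⁻¹ * ‖f.toLp 1‖ := by
  rw [SchwartzMap.norm_toLp_one, SchwartzMap.norm_toLp_one]
  have := Measure.integral_comp_smul (volume : Measure (Rd d)) (fun v => ‖f v‖) r
  rw [finrank_euclideanSpace_fin, abs_of_pos (by positivity)] at this
  simpa [dilate_apply] using this

theorem norm_schwartzGrad_dilate {r : ℝ} (hr : 0 < r) (f : 𝓢(Rd d, ℂ)) :
    ‖schwartzGrad d (dilate hr.ne' f)‖ = r * (r ^ d)⁻¹ * ‖schwartzGrad d f‖ := by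
  have h : ∀ j, ‖schwartzGrad d (dilate hr.ne' f) j‖ =
      r * (r ^ d)⁻¹ * ‖schwartzGrad d f j‖ := by
    intro j
    have e : (r • dilate hr.ne' (∂_{stdVec j} f) : 𝓢(Rd d, ℂ)).toLp 1 volume =
        r • (dilate hr.ne' (∂_{stdVec j} f)).toLp 1 volume := by
      exact map_smul (SchwartzMap.toLpCLM ℝ ℂ 1 (volume : Measure (Rd d))) r _
    rw [schwartzGrad_apply, schwartzGrad_apply, lineDerivOp_dilate, e, norm_smul,
      norm_toLp_dilate hr, Real.norm_of_nonneg hr.le, mul_assoc]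
  refine le_antisymm ?_ ?_
  · refine (pi_norm_le_iff_of_nonneg (by positivity)).2 fun j => ?_
    rw [h]
    gcongr
    exact norm_le_pi_norm _ j
  · have hc : 0 < r * (r ^ d)⁻¹ := by positivity
    rw [mul_comm, ← le_div_iff₀ hc]
    refine (pi_norm_le_iff_of_nonneg (by positivity)).2 fun j => ?_
    rw [le_div_iff₀ hc, mul_comm, ← h]
    exact norm_le_pi_norm _ j

/-- A smooth bump function on `ℝ^d`, equal to `1` on the ball of radius `2` and supported in the
ball of radius `3`. -/
def cutoffBump (d : ℕ) : ContDiffBump (0 : Rd d) := ⟨2, 3, by norm_num, by norm_num⟩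

/-- The smooth bump function `cutoffBump` as a complex-valued Schwartz function. -/
def cutoff (d : ℕ) : 𝓢(Rd d, ℂ) :=
  ((cutoffBump d).hasCompactSupport.comp_left (g := Complex.ofRealCLM) rfl).toSchwartzMap
    (Complex.ofRealCLM.contDiff.comp (cutoffBump d).contDiff)

theorem cutoff_apply (ξ : Rd d) : cutoff d ξ = (cutoffBump d ξ : ℂ) := rfl

theorem cutoff_eq_one {ξ : Rd d} (h : ‖ξ‖ ≤ 2) : cutoff d ξ = 1 := by
  rw [cutoff_apply, (cutoffBump d).one_of_mem_closedBall (by simpa using! h), Complex.ofReal_one]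

theorem cutoff_eq_zero {ξ : Rd d} (h : 3 ≤ ‖ξ‖) : cutoff d ξ = 0 := by
  rw [cutoff_apply, (cutoffBump d).zero_of_le_dist (by simpa using! h), Complex.ofReal_zero]

/-- The Schwartz function whose Fourier transform is `cutoff`. -/
def lowPass (d : ℕ) : 𝓢(Rd d, ℂ) := 𝓕⁻ (cutoff d)

theorem fourier_lowPass : 𝓕 (lowPass d) = cutoff d := FourierTransform.fourier_fourierInv_eq _

theorem fourier_dilate {r : ℝ} (hr : 0 < r) (f : 𝓢(Rd d, ℂ)) (ξ : Rd d) :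
    𝓕 (dilate hr.ne' f) ξ = ((r ^ d)⁻¹ : ℝ) • 𝓕 f (r⁻¹ • ξ) := by
  rw [SchwartzMap.fourier_coe, SchwartzMap.fourier_coe]
  exact fourier_comp_smul hr f ξ

theorem norm_le_sum_abs (ξ : Rd d) : ‖ξ‖ ≤ ∑ j, |ξ j| := by
  calc ‖ξ‖ = ‖∑ j, ξ j • EuclideanSpace.basisFun (Fin d) ℝ j‖ := by
        congr 1
        simpa using! ((EuclideanSpace.basisFun (Fin d) ℝ).sum_repr ξ).symm
    _ ≤ ∑ j, ‖ξ j • EuclideanSpace.basisFun (Fin d) ℝ j‖ := norm_sum_le _ _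
    _ = ∑ j, |ξ j| := by simp [norm_smul]

/-- On this annulus the dilated low-pass function has Fourier transform exactly `r^{-d}`, while its
gradient has norm proportional to `r · r^{-d}`. The factor `r^{-d}` cancels, and the remaining `r`
is absorbed by `r ≤ ‖ξ‖ ≤ ∑ |ξ_j|`, so the bound is independent of `r`. -/
theorem IsMultiplierWith.ae_norm_le_on_annulus {m : Rd d → ℂ} {T : W11 d →L[ℂ] W11 d}
    (h : IsMultiplierWith m T) {r : ℝ} (hr : 0 < r) :
    ∀ᵐ ξ, r ≤ ‖ξ‖ → ‖ξ‖ ≤ 2 * r →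
      ‖m ξ‖ ≤ d * (‖T‖ * (d * ‖schwartzGrad d (lowPass d)‖)) := by
  filter_upwards [ae_all_iff.2 fun j => h.ae_norm_le (dilate hr.ne' (lowPass d)) j] with ξ hξ h1 h2
  have h3 : ‖r⁻¹ • ξ‖ ≤ 2 := by
    rw [norm_smul, Real.norm_of_nonneg (by positivity), inv_mul_le_iff₀ hr]
    linarith
  have key : ∀ j, ‖m ξ‖ * |ξ j| ≤ r * (‖T‖ * (d * ‖schwartzGrad d (lowPass d)‖)) := by
    intro j
    have := hξ j
    rw [fourier_lineDerivOp_apply, fourier_dilate hr, fourier_lowPass, cutoff_eq_one h3,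
      norm_schwartzGrad_dilate hr, norm_mul, norm_mul, norm_derivSymbol, norm_smul, norm_one, mul_one,
      Real.norm_of_nonneg (by positivity)] at this
    have hc : 0 < (r ^ d)⁻¹ := by positivity
    have h4 : ‖m ξ‖ * (2 * Real.pi * |ξ j|) ≤
        r * (‖T‖ * (d * ‖schwartzGrad d (lowPass d)‖)) := by
      refine le_of_mul_le_mul_right ?_ hc
      linarith
    refine le_trans ?_ h4
    gcongr
    refine le_mul_of_one_le_left (abs_nonneg _) ?_
    linarith [Real.pi_gt_three]
  have h5 : ‖m ξ‖ * r ≤ d * (‖T‖ * (d * ‖schwartzGrad d (lowPass d)‖)) * r := by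
    calc ‖m ξ‖ * r ≤ ‖m ξ‖ * ∑ j, |ξ j| := by
          gcongr
          exact h1.trans (norm_le_sum_abs ξ)
      _ = ∑ j, ‖m ξ‖ * |ξ j| := Finset.mul_sum _ _ _
      _ ≤ ∑ j : Fin d, r * (‖T‖ * (d * ‖schwartzGrad d (lowPass d)‖)) :=
          Finset.sum_le_sum fun j _ => key j
      _ = _ := by
          simp
          ring
  exact le_of_mul_le_mul_right h5 hr

/-- The countably many dyadic annuli cover everything except the origin, which is a null set in
positive dimension. -/
theorem IsMultiplierWith.ae_norm_le_const [NeZero d] {m : Rd d → ℂ} {T : W11 d →L[ℂ] W11 d}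
    (h : IsMultiplierWith m T) :
    ∀ᵐ ξ, ‖m ξ‖ ≤ d * (‖T‖ * (d * ‖schwartzGrad d (lowPass d)‖)) := by
  have h0 : ∀ᵐ ξ : Rd d, ξ ≠ 0 := compl_mem_ae_iff.2 (measure_singleton 0)
  filter_upwards [ae_all_iff.2 fun n : ℤ =>
    h.ae_norm_le_on_annulus (zpow_pos (two_pos : (0 : ℝ) < 2) n), h0] with ξ hξ hne
  obtain ⟨n, h1, h2⟩ := exists_mem_Ico_zpow (norm_pos_iff.2 hne) (one_lt_two : (1 : ℝ) < 2)
  refine hξ n h1 ?_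
  rw [zpow_add_one₀ two_ne_zero] at h2
  linarith

/-! ### Passage to the limit on Schwartz functions. -/

theorem memLp_top_of_tendsto [NeZero d] {m : ℕ → Rd d → ℂ} {m₀ : Rd d → ℂ}
    {T : ℕ → (W11 d →L[ℂ] W11 d)} (hT : ∀ k, IsMultiplierWith (m k) (T k)) {C : ℝ}
    (hC : ∀ k, ‖T k‖ ≤ C) (hlim : ∀ ξ, Tendsto (fun k => m k ξ) atTop (𝓝 (m₀ ξ))) :
    MemLp m₀ ∞ volume := by
  refine memLp_top_of_bound (C := d * (C * (d * ‖schwartzGrad d (lowPass d)‖)))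
    (aestronglyMeasurable_of_tendsto_ae atTop (fun k => (hT k).1.aestronglyMeasurable)
      (ae_of_all _ hlim)) ?_
  filter_upwards [ae_all_iff.2 fun k => (hT k).ae_norm_le_const] with ξ hξ
  refine le_of_tendsto (hlim ξ).norm (Eventually.of_forall fun k => (hξ k).trans ?_)
  gcongr
  exact hC k

theorem exists_limit_grad [NeZero d] {m : ℕ → Rd d → ℂ} {m₀ : Rd d → ℂ}
    {T : ℕ → (W11 d →L[ℂ] W11 d)} (hT : ∀ k, IsMultiplierWith (m k) (T k)) {C : ℝ}
    (hC : ∀ k, ‖T k‖ ≤ C) (hlim : ∀ ξ, Tendsto (fun k => m k ξ) atTop (𝓝 (m₀ ξ)))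
    (f : 𝓢(Rd d, ℂ)) (j : Fin d) :
    ∃ g : Rd d →₁[volume] ℂ,
      (g =ᵐ[volume] 𝓕⁻ fun ξ => m₀ ξ * 𝓕 (∂_{stdVec j} f : 𝓢(Rd d, ℂ)) ξ) ∧
      ‖g‖ ≤ C * (d * ‖schwartzGrad d f‖) := by
  have hC0 : 0 ≤ C := (ContinuousLinearMap.opNorm_nonneg _).trans (hC 0)
  set F : 𝓢(Rd d, ℂ) := 𝓕 (∂_{stdVec j} f) with hF
  have hm₀ := memLp_top_of_tendsto hT hC hlim
  have hcont : Continuous (𝓕⁻ fun ξ => m₀ ξ * F ξ) :=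
    continuous_fourierInv (integrable_mul_schwartz hm₀ F)
  have hconv : ∀ x, Tendsto (fun k => 𝓕⁻ (fun ξ => m k ξ * F ξ) x) atTop
      (𝓝 (𝓕⁻ (fun ξ => m₀ ξ * F ξ) x)) := by
    intro x
    simp only [Real.fourierInv_eq]
    refine tendsto_integral_of_dominated_convergence
      (fun ξ => d * (C * (d * ‖schwartzGrad d (lowPass d)‖)) * ‖F ξ‖) (fun k => ?_)
      (F.integrable.norm.const_mul _) (fun k => ?_) (ae_of_all _ fun ξ => ?_)
    · have hch : Continuous fun ξ : Rd d => Real.fourierChar (inner ℝ ξ x) :=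
        Real.continuous_fourierChar.comp (by fun_prop)
      exact hch.aestronglyMeasurable.smul
        (integrable_mul_schwartz (hT k).1 F).aestronglyMeasurable
    · filter_upwards [(hT k).ae_norm_le_const] with ξ hξ
      rw [Circle.norm_smul, norm_mul]
      gcongr
      refine hξ.trans ?_
      gcongr
      exact hC k
    · exact ((hlim ξ).mul_const _).const_smul _
  choose g hg hgn using fun k => (hT k).exists_grad f j
  -- Fatou's lemma along the pointwise convergence `hconv`: the `L¹` norm of the limit is at most
  -- the lower limit of the norms.
  have hle : eLpNorm (𝓕⁻ fun ξ => m₀ ξ * F ξ) 1 volume ≤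
      ENNReal.ofReal (C * (d * ‖schwartzGrad d f‖)) := by
    refine (Lp.eLpNorm_lim_le_liminf_eLpNorm (f := fun k => 𝓕⁻ fun ξ => m k ξ * F ξ)
      (fun k => (continuous_fourierInv
        (integrable_mul_schwartz (hT k).1 F)).aestronglyMeasurable) _
      (ae_of_all _ hconv)).trans ?_
    refine liminf_le_of_frequently_le' (Frequently.of_forall fun k => ?_)
    rw [← eLpNorm_congr_ae (hg k), ← ENNReal.ofReal_toReal (Lp.eLpNorm_ne_top (g k)),
      ← Lp.norm_def]
    refine ENNReal.ofReal_le_ofReal ((hgn k).trans ?_)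
    gcongr
    exact hC k
  have hmem : MemLp (𝓕⁻ fun ξ => m₀ ξ * F ξ) 1 volume :=
    ⟨hcont.aestronglyMeasurable, hle.trans_lt ENNReal.ofReal_lt_top⟩
  refine ⟨hmem.toLp _, hmem.coeFn_toLp, ?_⟩
  rw [Lp.norm_toLp]
  exact ENNReal.toReal_le_of_le_ofReal (by positivity) hle

/-! ### Gradients are curl-free, in Fourier form. -/

theorem testToSchwartz_injective : Function.Injective (testToSchwartz (d := d)) := by
  intro φ ψ h
  ext x
  have := congrArg (fun f : 𝓢(Rd d, ℂ) => f x) h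
  exact Complex.ofReal_injective this

theorem schwartz_lineDerivOp_comm (f : 𝓢(Rd d, ℂ)) (i j : Fin d) :
    ∂_{stdVec i} (∂_{stdVec j} f) = ∂_{stdVec j} (∂_{stdVec i} f) := by
  have h : (𝓕 (∂_{stdVec i} (∂_{stdVec j} f) : 𝓢(Rd d, ℂ)) : 𝓢(Rd d, ℂ)) =
      𝓕 (∂_{stdVec j} (∂_{stdVec i} f) : 𝓢(Rd d, ℂ)) := by
    ext ξ
    simp only [fourier_lineDerivOp_apply]
    ring
  simpa only [FourierTransform.fourierInv_fourier_eq] using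
    congrArg (fun g : 𝓢(Rd d, ℂ) => (𝓕⁻ g : 𝓢(Rd d, ℂ))) h

theorem integral_lineDerivOp_mul_grad_comm (u : PreW11 d) (i j : Fin d)
    (φ : 𝓓((⊤ : Opens (Rd d)), ℝ)) :
    ∫ x, (∂_{stdVec i} (testToSchwartz φ) : 𝓢(Rd d, ℂ)) x * PreW11.grad j u x =
      ∫ x, (∂_{stdVec j} (testToSchwartz φ) : 𝓢(Rd d, ℂ)) x * PreW11.grad i u x := by
  have key : ∀ i j : Fin d,
      ∫ x, (∂_{stdVec i} (testToSchwartz φ) : 𝓢(Rd d, ℂ)) x * PreW11.grad j u x =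
        -PreW11.toDistr d u (∂_{stdVec j} (∂_{stdVec i} φ)) := by
    intro i j
    rw [← pderiv_apply, ← PreW11.ofL1_grad, ← testToSchwartz_lineDerivOp]
    exact (ofFun_apply_eq_integral_mul (L1_locallyIntegrable _) _).symm
  have hcomm : ∂_{stdVec j} (∂_{stdVec i} φ) = ∂_{stdVec i} (∂_{stdVec j} φ) := by
    apply testToSchwartz_injective
    simp only [testToSchwartz_lineDerivOp]
    exact schwartz_lineDerivOp_comm _ _ _
  rw [key, key, hcomm]

open scoped Convolution in
theorem grad_convolution_lineDerivOp_comm (u : PreW11 d) (i j : Fin d)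
    (φ : 𝓓((⊤ : Opens (Rd d)), ℝ)) :
    ((PreW11.grad j u : Rd d → ℂ) ⋆[ContinuousLinearMap.mul ℂ ℂ]
        (∂_{stdVec i} (testToSchwartz φ) : 𝓢(Rd d, ℂ))) =
      ((PreW11.grad i u : Rd d → ℂ) ⋆[ContinuousLinearMap.mul ℂ ℂ]
        (∂_{stdVec j} (testToSchwartz φ) : 𝓢(Rd d, ℂ))) := by
  ext x
  -- Testing against the reflected translate turns the pairing into the value of the convolution at
  -- `x`.
  let ψ : 𝓓((⊤ : Opens (Rd d)), ℝ) :=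
    ⟨fun y => φ (x - y), φ.contDiff.comp (contDiff_const.sub contDiff_id),
      φ.hasCompactSupport.comp_homeomorph (Homeomorph.subLeft x), fun _ _ => trivial⟩
  have hψ : ∀ (v y : Rd d), (∂_{v} (testToSchwartz ψ) : 𝓢(Rd d, ℂ)) y =
      -(∂_{v} (testToSchwartz φ) : 𝓢(Rd d, ℂ)) (x - y) := by
    intro v y
    rw [SchwartzMap.lineDerivOp_apply_eq_fderiv, SchwartzMap.lineDerivOp_apply_eq_fderiv]
    have : (testToSchwartz ψ : Rd d → ℂ) = fun y => testToSchwartz φ (x - y) := rfl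
    have h1 : HasFDerivAt (fun y => testToSchwartz φ (x - y))
        ((fderiv ℝ (testToSchwartz φ) (x - y)).comp (-ContinuousLinearMap.id ℝ (Rd d))) y :=
      ((testToSchwartz φ).differentiableAt.hasFDerivAt).comp y
        ((hasFDerivAt_id y).const_sub x)
    rw [this, h1.fderiv]
    simp
  have h := integral_lineDerivOp_mul_grad_comm u i j ψ
  simp only [hψ, neg_mul, integral_neg, neg_inj] at h
  simpa [convolution_def, mul_comm] using h

/-- The transform of a bump `b(r·)` at `ξ` is a positive multiple of the transform of `b` at `ξ /
r`, which tends to `∫ b > 0` as `r → ∞`. -/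
theorem exists_testFunction_fourier_ne_zero (ξ : Rd d) :
    ∃ φ : 𝓓((⊤ : Opens (Rd d)), ℝ), 𝓕 (testToSchwartz φ) ξ ≠ 0 := by
  let b : ContDiffBump (0 : Rd d) := ⟨1, 2, by norm_num, by norm_num⟩
  have hint : Integrable fun x => (b x : ℂ) := b.integrable.ofReal
  have h0 : 𝓕 (fun x => (b x : ℂ)) 0 ≠ 0 := by
    rw [fourier_zero, integral_complex_ofReal]
    exact_mod_cast b.integral_pos.ne'
  have hc : Tendsto (fun r : ℝ => 𝓕 (fun x => (b x : ℂ)) (r⁻¹ • ξ)) atTop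
      (𝓝 (𝓕 (fun x => (b x : ℂ)) 0)) := by
    refine ((continuous_fourier hint).tendsto 0).comp ?_
    simpa using (tendsto_inv_atTop_zero (𝕜 := ℝ)).smul_const ξ
  obtain ⟨r, hr, hr0⟩ := ((hc.eventually_ne h0).and (eventually_gt_atTop 0)).exists
  refine ⟨⟨fun x => b (r • x), b.contDiff.comp (contDiff_const_smul r),
    b.hasCompactSupport.comp_smul hr0.ne', fun _ _ => trivial⟩, ?_⟩
  rw [SchwartzMap.fourier_coe]
  change 𝓕 (fun x => (b (r • x) : ℂ)) ξ ≠ 0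
  rw [fourier_comp_smul hr0 (fun x => (b x : ℂ))]
  exact smul_ne_zero (by positivity) hr

/-- Since `u` need not be known to be tempered, only its derivatives are transformed. Mollifying by
`φ` and transforming gives the identity times `𝓕 φ ξ`, and `φ` is chosen so that this factor can be
cancelled. -/
theorem derivSymbol_mul_fourier_grad_comm (u : PreW11 d) (i j : Fin d) (ξ : Rd d) :
    derivSymbol i ξ * 𝓕 (PreW11.grad j u : Rd d → ℂ) ξ =
      derivSymbol j ξ * 𝓕 (PreW11.grad i u : Rd d → ℂ) ξ := by
  obtain ⟨φ, hφ⟩ := exists_testFunction_fourier_ne_zero ξ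
  have h := congrArg (fun g : Rd d → ℂ => 𝓕 g ξ) (grad_convolution_lineDerivOp_comm u i j φ)
  rw [Real.fourier_mul_convolution_eq (L1.integrable_coeFn _) (SchwartzMap.integrable _),
    Real.fourier_mul_convolution_eq (L1.integrable_coeFn _) (SchwartzMap.integrable _),
    ← SchwartzMap.fourier_coe, ← SchwartzMap.fourier_coe, fourier_lineDerivOp_apply,
    fourier_lineDerivOp_apply] at h
  refine mul_right_cancel₀ hφ ?_
  linear_combination h

/-- The Fourier transform of an integrable function at a point, as a continuous functional. -/
def fourierAt (ξ : Rd d) : (Rd d →₁[volume] ℂ) →L[ℂ] ℂ :=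
  LinearMap.mkContinuous
    { toFun g := 𝓕 (g : Rd d → ℂ) ξ
      map_add' f g := by
        rw [Real.fourier_congr_ae (Lp.coeFn_add f g)]
        exact congrFun (VectorFourier.fourierIntegral_add Real.continuous_fourierChar
          continuous_inner (L1.integrable_coeFn f) (L1.integrable_coeFn g)) ξ
      map_smul' c f := by
        rw [Real.fourier_congr_ae (Lp.coeFn_smul c f)]
        exact congrFun (VectorFourier.fourierIntegral_const_smul _ _ _ _ c) ξ }
    1 fun g => by
      rw [one_mul, L1.norm_eq_integral_norm]
      exact norm_fourier_le _ ξ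

theorem fourierAt_apply (ξ : Rd d) (g : Rd d →₁[volume] ℂ) :
    fourierAt ξ g = 𝓕 (g : Rd d → ℂ) ξ := rfl

theorem norm_fourierAt_le (ξ : Rd d) (g : Rd d →₁[volume] ℂ) : ‖fourierAt ξ g‖ ≤ ‖g‖ := by
  simpa using (fourierAt ξ).le_of_opNorm_le (LinearMap.mkContinuous_norm_le _ zero_le_one _) g

/-- The tuples of integrable functions that are curl-free. -/
def curlFree (d : ℕ) : Submodule ℂ (Fin d → (Rd d →₁[volume] ℂ)) :=
  ⨅ (i : Fin d) (j : Fin d) (ξ : Rd d), LinearMap.ker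
    (derivSymbol i ξ • (fourierAt ξ).comp (ContinuousLinearMap.proj j) -
      derivSymbol j ξ • (fourierAt ξ).comp (ContinuousLinearMap.proj i) :
      (Fin d → (Rd d →₁[volume] ℂ)) →L[ℂ] ℂ).toLinearMap

theorem mem_curlFree {h : Fin d → (Rd d →₁[volume] ℂ)} :
    h ∈ curlFree d ↔ ∀ i j ξ,
      derivSymbol i ξ * fourierAt ξ (h j) = derivSymbol j ξ * fourierAt ξ (h i) := by
  simp [curlFree, Submodule.mem_iInf, sub_eq_zero]

theorem isClosed_curlFree (d : ℕ) : IsClosed (curlFree d : Set (Fin d → (Rd d →₁[volume] ℂ))) := by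
  simp only [curlFree, Submodule.coe_iInf]
  exact isClosed_iInter fun i => isClosed_iInter fun j => isClosed_iInter fun ξ =>
    ContinuousLinearMap.isClosed_ker _

instance (d : ℕ) : CompleteSpace (curlFree d) := (isClosed_curlFree d).completeSpace_coe

/-- The gradient, as a bounded operator into the curl-free tuples of integrable functions. -/
def gradient (d : ℕ) : W11 d →L[ℂ] curlFree d :=
  (ContinuousLinearMap.pi gradW).codRestrict (curlFree d) fun q => by
    obtain ⟨u, rfl⟩ := Submodule.Quotient.mk_surjective _ q
    exact mem_curlFree.2 fun i j ξ => derivSymbol_mul_fourier_grad_comm u i j ξ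

/-! ### Translation and convolution on `L¹`. -/

/-- The translation `g ↦ g (· - y)` on `L¹(ℝ^d)`. -/
def translate (y : Rd d) : (Rd d →₁[volume] ℂ) →ₗᵢ[ℂ] (Rd d →₁[volume] ℂ) :=
  Lp.compMeasurePreservingₗᵢ ℂ (fun x => x - y) (measurePreserving_sub_right volume y)

theorem coeFn_translate (y : Rd d) (g : Rd d →₁[volume] ℂ) :
    translate y g =ᵐ[volume] fun x => g (x - y) :=
  Lp.coeFn_compMeasurePreserving g (measurePreserving_sub_right volume y)

theorem continuous_translate (g : Rd d →₁[volume] ℂ) : Continuous fun y => translate y g := by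
  let F : C(Rd d, C(Rd d, Rd d)) :=
    (ContinuousMap.mk (fun p : Rd d × Rd d => p.2 - p.1) (by fun_prop)).curry
  exact Continuous.compMeasurePreservingLp (f := fun _ => g) (g := fun y => F y)
    continuous_const F.continuous (fun y => measurePreserving_sub_right volume y) ENNReal.one_ne_top

theorem translate_zero (g : Rd d →₁[volume] ℂ) : translate 0 g = g := by
  refine Lp.ext ((coeFn_translate 0 g).trans ?_)
  simp

theorem fourierAt_translate (ξ y : Rd d) (g : Rd d →₁[volume] ℂ) :
    fourierAt ξ (translate y g) = Real.fourierChar (-inner ℝ y ξ) • fourierAt ξ g := by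
  rw [fourierAt_apply, fourierAt_apply, Real.fourier_congr_ae (coeFn_translate y g)]
  have := congrFun (VectorFourier.fourierIntegral_comp_add_right Real.fourierChar volume
    (innerₗ (Rd d)) g (-y)) ξ
  simpa [sub_eq_add_neg] using! this

theorem fourierAt_injective {f g : Rd d →₁[volume] ℂ} (h : ∀ ξ, fourierAt ξ f = fourierAt ξ g) :
    f = g :=
  Lp.ext (ae_eq_of_fourier_eq (L1.integrable_coeFn f) (L1.integrable_coeFn g) (funext h))

theorem integrable_smul_translate (a b : Rd d →₁[volume] ℂ) :
    Integrable fun y => a y • translate y b := by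
  refine ((L1.integrable_coeFn a).norm.mul_const ‖b‖).mono'
    ((L1.integrable_coeFn a).aestronglyMeasurable.smul
      (continuous_translate b).aestronglyMeasurable) (ae_of_all _ fun y => ?_)
  rw [norm_smul, LinearIsometry.norm_map]

/-- Convolution with an integrable function, as a bounded operator on `L¹(ℝ^d)`. -/
def conv (a : Rd d →₁[volume] ℂ) : (Rd d →₁[volume] ℂ) →L[ℂ] (Rd d →₁[volume] ℂ) :=
  LinearMap.mkContinuous
    { toFun b := ∫ y, a y • translate y b
      map_add' b c := by
        simp only [map_add, smul_add]
        exact integral_add (integrable_smul_translate a b) (integrable_smul_translate a c)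
      map_smul' t b := by
        simp only [map_smul, RingHom.id_apply]
        rw [← integral_smul]
        congr with y
        rw [smul_comm] }
    ‖a‖ fun b => by
      refine (norm_integral_le_integral_norm _).trans ?_
      simp only [norm_smul, LinearIsometry.norm_map]
      rw [integral_mul_const, L1.norm_eq_integral_norm a]

theorem conv_apply (a b : Rd d →₁[volume] ℂ) : conv a b = ∫ y, a y • translate y b := rfl

theorem fourierAt_conv (ξ : Rd d) (a b : Rd d →₁[volume] ℂ) :
    fourierAt ξ (conv a b) = fourierAt ξ a * fourierAt ξ b := by
  rw [conv_apply, ← ContinuousLinearMap.integral_comp_comm _ (integrable_smul_translate a b)]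
  simp only [map_smul, fourierAt_translate]
  rw [fourierAt_apply ξ a, Real.fourier_eq, ← integral_mul_const]
  congr with y
  simp only [Circle.smul_def, smul_eq_mul]
  ring

theorem conv_comm (a b : Rd d →₁[volume] ℂ) : conv a b = conv b a :=
  fourierAt_injective fun ξ => by rw [fourierAt_conv, fourierAt_conv, mul_comm]

/-- The difference is `∫ a(y) (τ_y b - b) dy`. This serves both limits of the low-pass kernels: `a`
is the kernel at high frequency, and `b` is the kernel at low frequency. -/
theorem norm_conv_sub_le (a b : Rd d →₁[volume] ℂ) :
    ‖conv a b - fourierAt 0 a • b‖ ≤ ∫ y, ‖a y‖ * ‖translate y b - b‖ := by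
  have h : conv a b - fourierAt 0 a • b = ∫ y, a y • (translate y b - b) := by
    simp only [smul_sub]
    rw [integral_sub (integrable_smul_translate a b) ((L1.integrable_coeFn a).smul_const b),
      integral_smul_const, conv_apply, fourierAt_apply, fourier_zero]
  rw [h]
  refine (norm_integral_le_integral_norm _).trans (le_of_eq ?_)
  simp only [norm_smul]

theorem norm_translate_sub_le (y : Rd d) (b : Rd d →₁[volume] ℂ) :
    ‖translate y b - b‖ ≤ 2 * ‖b‖ := by
  refine (norm_sub_le _ _).trans ?_
  rw [LinearIsometry.norm_map, two_mul]

theorem continuous_norm_translate_sub (b : Rd d →₁[volume] ℂ) :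
    Continuous fun y => ‖translate y b - b‖ :=
  ((continuous_translate b).sub continuous_const).norm

theorem tendsto_integral_mul_norm_translate_sub {a : Rd d → ℂ} (ha : Integrable a)
    (b : Rd d →₁[volume] ℂ) {ι : Type*} {l : Filter ι} [l.IsCountablyGenerated] {s : ι → ℝ}
    (hs : Tendsto s l (𝓝 0)) :
    Tendsto (fun i => ∫ y, ‖a y‖ * ‖translate (s i • y) b - b‖) l (𝓝 0) := by
  have h := tendsto_integral_filter_of_dominated_convergence (μ := volume) (l := l)
    (F := fun i y => ‖a y‖ * ‖translate (s i • y) b - b‖) (f := fun _ => (0 : ℝ))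
    (fun y => ‖a y‖ * (2 * ‖b‖)) ?_ ?_ (ha.norm.mul_const _) ?_
  · simpa using h
  · refine Eventually.of_forall fun i => ha.norm.aestronglyMeasurable.mul ?_
    exact ((continuous_norm_translate_sub b).comp (continuous_const_smul (s i))).aestronglyMeasurable
  · refine Eventually.of_forall fun i => ae_of_all _ fun y => ?_
    rw [Real.norm_of_nonneg (by positivity)]
    gcongr
    exact norm_translate_sub_le _ b
  · refine ae_of_all _ fun y => ?_
    have h0 : Tendsto (fun i => s i • y) l (𝓝 0) := by simpa using hs.smul_const y
    have h1 := ((continuous_norm_translate_sub b).tendsto 0).comp h0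
    rw [translate_zero, sub_self, norm_zero] at h1
    simpa using h1.const_mul ‖a y‖

/-! ### Low-pass kernels at large and small radius. -/

theorem fourierAt_toLp (ξ : Rd d) (f : 𝓢(Rd d, ℂ)) : fourierAt ξ (f.toLp 1) = 𝓕 f ξ := by
  rw [fourierAt_apply, Real.fourier_congr_ae (SchwartzMap.coeFn_toLp f 1 volume),
    SchwartzMap.fourier_coe]

/-- The Schwartz function whose Fourier transform is `ξ ↦ cutoff (ξ / r)`. -/
def lowPassKernel (d : ℕ) {r : ℝ} (hr : 0 < r) : 𝓢(Rd d, ℂ) :=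
  (r ^ d) • dilate hr.ne' (lowPass d)

theorem lowPassKernel_apply {r : ℝ} (hr : 0 < r) (x : Rd d) :
    lowPassKernel d hr x = (r ^ d) • lowPass d (r • x) := rfl

theorem fourier_lowPassKernel {r : ℝ} (hr : 0 < r) (ξ : Rd d) :
    𝓕 (lowPassKernel d hr) ξ = cutoff d (r⁻¹ • ξ) := by
  rw [lowPassKernel, FourierTransform.fourier_smul, smul_apply, fourier_dilate hr,
    fourier_lowPass, smul_smul, mul_inv_cancel₀ (by positivity), one_smul]

theorem integral_smul_comp_smul {r : ℝ} (hr : 0 < r) (g : Rd d → ℝ) :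
    ∫ x, (r ^ d) * g (r • x) = ∫ x, g x := by
  have := Measure.integral_comp_smul (volume : Measure (Rd d)) g r
  rw [finrank_euclideanSpace_fin, abs_of_pos (by positivity), smul_eq_mul] at this
  rw [integral_const_mul, this, mul_inv_cancel_left₀ (by positivity)]

theorem norm_translate_toLp_sub (y : Rd d) (f : 𝓢(Rd d, ℂ)) :
    ‖translate y (f.toLp 1 volume) - f.toLp 1 volume‖ = ∫ x, ‖f (x - y) - f x‖ := by
  rw [L1.norm_eq_integral_norm]
  refine integral_congr_ae ?_
  have h1 := f.coeFn_toLp 1 volume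
  have h2 := (measurePreserving_sub_right volume y).quasiMeasurePreserving.ae_eq_comp h1
  filter_upwards [Lp.coeFn_sub (translate y (f.toLp 1 volume)) (f.toLp 1 volume),
    coeFn_translate y (f.toLp 1 volume), h1, h2] with x hx hx2 hx3 hx4
  simp only [Function.comp_apply] at hx4
  rw [hx, Pi.sub_apply, hx2, hx3, hx4]

theorem norm_translate_lowPassKernel_sub {r : ℝ} (hr : 0 < r) (y : Rd d) :
    ‖translate y ((lowPassKernel d hr).toLp 1 volume) - (lowPassKernel d hr).toLp 1 volume‖ =
      ‖translate (r • y) ((lowPass d).toLp 1 volume) - (lowPass d).toLp 1 volume‖ := by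
  rw [norm_translate_toLp_sub, norm_translate_toLp_sub,
    ← integral_smul_comp_smul hr fun x => ‖lowPass d (x - r • y) - lowPass d x‖]
  congr with x
  rw [lowPassKernel_apply, lowPassKernel_apply, ← smul_sub, norm_smul,
    Real.norm_of_nonneg (by positivity), smul_sub]

/-- An approximate identity: the kernels have integral `1`, and rescaling the integral moves the
dilation into translations of `g` by `y / r`. -/
theorem tendsto_conv_lowPassKernel_atTop {r : ℕ → ℝ} (hr : ∀ n, 0 < r n)
    (hr' : Tendsto r atTop atTop) (g : Rd d →₁[volume] ℂ) :
    Tendsto (fun n => conv ((lowPassKernel d (hr n)).toLp 1) g) atTop (𝓝 g) := by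
  rw [tendsto_iff_norm_sub_tendsto_zero]
  refine squeeze_zero (fun n => norm_nonneg _) (fun n => ?_)
    (tendsto_integral_mul_norm_translate_sub (lowPass d).integrable g
      (tendsto_inv_atTop_zero.comp hr'))
  have h := norm_conv_sub_le ((lowPassKernel d (hr n)).toLp 1) g
  rw [fourierAt_toLp, fourier_lowPassKernel, smul_zero, cutoff_eq_one (by simp), one_smul] at h
  refine h.trans (le_of_eq ?_)
  rw [← integral_smul_comp_smul (hr n) fun y => ‖lowPass d y‖ * _]
  refine integral_congr_ae ?_
  filter_upwards [(lowPassKernel d (hr n)).coeFn_toLp 1 volume] with x hx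
  rw [hx, lowPassKernel_apply, norm_smul, Real.norm_of_nonneg (by have := hr n; positivity),
    Function.comp_apply, smul_smul, inv_mul_cancel₀ (hr n).ne', one_smul, mul_assoc]

/-- With the roles exchanged, the mean-zero `g` integrates the differences `τ_y k - k` of the
kernel. By scaling these have the size of a translation of `lowPass` by `r y`, which tends to zero.
-/
theorem tendsto_conv_lowPassKernel_zero {r : ℕ → ℝ} (hr : ∀ n, 0 < r n)
    (hr' : Tendsto r atTop (𝓝 0)) {g : Rd d →₁[volume] ℂ} (hg : fourierAt 0 g = 0) :
    Tendsto (fun n => conv ((lowPassKernel d (hr n)).toLp 1) g) atTop (𝓝 0) := by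
  rw [tendsto_zero_iff_norm_tendsto_zero]
  refine squeeze_zero (fun n => norm_nonneg _) (fun n => ?_)
    (tendsto_integral_mul_norm_translate_sub (L1.integrable_coeFn g) ((lowPass d).toLp 1) hr')
  have h := norm_conv_sub_le g ((lowPassKernel d (hr n)).toLp 1)
  rw [hg, zero_smul, sub_zero, conv_comm] at h
  simpa only [norm_translate_lowPassKernel_sub] using h

/-! ### Density of Schwartz gradients among mean-zero curl-free fields. -/

theorem sum_derivSymbol_mul_self (ξ : Rd d) :
    ∑ i, derivSymbol i ξ * derivSymbol i ξ = ((-(2 * Real.pi) ^ 2 * ‖ξ‖ ^ 2 : ℝ) : ℂ) := by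
  have : ∀ i, derivSymbol i ξ * derivSymbol i ξ = ((-(2 * Real.pi) ^ 2 * ‖ξ i‖ ^ 2 : ℝ) : ℂ) := by
    intro i
    rw [Real.norm_eq_abs, sq_abs]
    push_cast [derivSymbol]
    linear_combination (4 * (Real.pi : ℂ) ^ 2 * (ξ i : ℂ) ^ 2) * Complex.I_sq
  simp only [this]
  rw [← Complex.ofReal_sum, ← Finset.mul_sum, EuclideanSpace.norm_sq_eq]

/-- Both cutoffs equal `1` for `‖ξ‖ ≤ 2ρ`, so their difference vanishes near the origin and can be
divided by `-4π²‖ξ‖²` without losing smoothness or compact support. -/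
theorem exists_fourier_laplacian_eq {ρ R : ℝ} (hρ : 0 < ρ) (hR : 0 < R) (hρR : ρ ≤ R) :
    ∃ Q : 𝓢(Rd d, ℂ), ∀ ξ, (∑ i, derivSymbol i ξ * derivSymbol i ξ) * 𝓕 Q ξ =
      𝓕 (lowPassKernel d hR) ξ - 𝓕 (lowPassKernel d hρ) ξ := by
  have hscale : ∀ {r : ℝ}, 0 < r → ∀ ξ : Rd d, ‖r⁻¹ • ξ‖ = ‖ξ‖ / r := by
    intro r hr ξ
    rw [norm_smul, Real.norm_of_nonneg (by positivity), inv_mul_eq_div]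
  let p : Rd d → ℂ := fun ξ => cutoff d (R⁻¹ • ξ) - cutoff d (ρ⁻¹ • ξ)
  let q : Rd d → ℂ := fun ξ => (-(2 * Real.pi) ^ 2 * ‖ξ‖ ^ 2 : ℝ)⁻¹ • p ξ
  have hp : ContDiff ℝ ∞ p :=
    (((cutoff d).smooth ⊤).comp (contDiff_const_smul _)).sub
      (((cutoff d).smooth ⊤).comp (contDiff_const_smul _))
  have hp0 : ∀ ξ, ‖ξ‖ ≤ 2 * ρ → p ξ = 0 := by
    intro ξ hξ
    have h1 : ‖ρ⁻¹ • ξ‖ ≤ 2 := by rwa [hscale hρ, div_le_iff₀ hρ]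
    have h2 : ‖R⁻¹ • ξ‖ ≤ 2 := by
      rw [hscale hR, div_le_iff₀ hR]
      linarith
    simp only [p, cutoff_eq_one h1, cutoff_eq_one h2, sub_self]
  have hpR : ∀ ξ, 3 * R ≤ ‖ξ‖ → p ξ = 0 := by
    intro ξ hξ
    have h1 : 3 ≤ ‖ρ⁻¹ • ξ‖ := by
      rw [hscale hρ, le_div_iff₀ hρ]
      linarith
    have h2 : 3 ≤ ‖R⁻¹ • ξ‖ := by rwa [hscale hR, le_div_iff₀ hR]
    simp only [p, cutoff_eq_zero h1, cutoff_eq_zero h2, sub_self]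
  have hq : ContDiff ℝ ∞ q := by
    refine contDiff_iff_contDiffAt.2 fun ξ => ?_
    by_cases hξ : ξ = 0
    · have : q =ᶠ[𝓝 ξ] fun _ => 0 := by
        filter_upwards [Metric.ball_mem_nhds ξ (show 0 < 2 * ρ by positivity)] with η hη
        rw [hξ, mem_ball_zero_iff] at hη
        simp only [q, hp0 η hη.le, smul_zero]
      exact contDiffAt_const.congr_of_eventuallyEq this
    · have h1 : ContDiffAt ℝ ∞ (fun ξ : Rd d => (-(2 * Real.pi) ^ 2 * ‖ξ‖ ^ 2 : ℝ)) ξ :=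
        contDiffAt_const.mul (contDiff_norm_sq ℝ).contDiffAt
      refine (h1.inv ?_).smul hp.contDiffAt
      have := norm_pos_iff.2 hξ
      have h2 : 0 < (2 * Real.pi) ^ 2 * ‖ξ‖ ^ 2 := by positivity
      linarith
  have hqc : HasCompactSupport q := by
    refine HasCompactSupport.intro (isCompact_closedBall 0 (3 * R)) fun ξ hξ => ?_
    rw [mem_closedBall_zero_iff, not_le] at hξ
    simp only [q, hpR ξ hξ.le, smul_zero]
  refine ⟨𝓕⁻ (hqc.toSchwartzMap hq), fun ξ => ?_⟩
  rw [FourierTransform.fourier_fourierInv_eq, fourier_lowPassKernel, fourier_lowPassKernel,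
    sum_derivSymbol_mul_self]
  change _ * q ξ = p ξ
  by_cases hξ : ξ = 0
  · rw [hξ, hp0 0 (by simpa using hρ.le)]
    simp
  · have h1 := norm_pos_iff.2 hξ
    have h2 : 0 < (2 * Real.pi) ^ 2 * ‖ξ‖ ^ 2 := by positivity
    have h3 : (-(2 * Real.pi) ^ 2 * ‖ξ‖ ^ 2 : ℝ) ≠ 0 := by linarith
    rw [← Complex.real_smul, smul_inv_smul₀ h3]

/-- The convolution of the Hessian matrix of `Q` with a tuple of integrable functions. -/
def hessConv (Q : 𝓢(Rd d, ℂ)) (h : Fin d → (Rd d →₁[volume] ℂ)) : Fin d → (Rd d →₁[volume] ℂ) :=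
  fun j => ∑ i, conv ((∂_{stdVec j} (∂_{stdVec i} Q) : 𝓢(Rd d, ℂ)).toLp 1) (h i)

theorem hessConv_toLp_mem_range (Q : 𝓢(Rd d, ℂ)) (s : Fin d → 𝓢(Rd d, ℂ)) :
    hessConv Q (fun i => (s i).toLp 1) ∈ Set.range (schwartzGrad d) := by
  refine ⟨∑ i, SchwartzMap.convolution (ContinuousLinearMap.mul ℂ ℂ) (∂_{stdVec i} Q) (s i), ?_⟩
  rw [map_sum]
  ext1 j
  rw [Finset.sum_apply]
  refine Finset.sum_congr rfl fun i _ => fourierAt_injective fun ξ => ?_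
  simp only [schwartzGrad_apply, fourierAt_conv, fourierAt_toLp, fourier_lineDerivOp_apply,
    SchwartzMap.fourier_convolution, SchwartzMap.pairing_apply_apply,
    ContinuousLinearMap.mul_apply']
  ring

/-- For Schwartz tuples the value is the gradient of `∑ ∂_i Q ∗ s_i`; the general case follows by
density in `L¹` and continuity. -/
theorem hessConv_mem_closure (Q : 𝓢(Rd d, ℂ)) (h : Fin d → (Rd d →₁[volume] ℂ)) :
    hessConv Q h ∈ closure (Set.range (schwartzGrad d)) := by
  have hd : DenseRange fun (s : Fin d → 𝓢(Rd d, ℂ)) (i : Fin d) => (s i).toLp 1 volume :=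
    DenseRange.piMap fun _ => SchwartzMap.denseRange_toLpCLM ENNReal.one_ne_top
  have hc : Continuous (hessConv Q) := continuous_pi fun j => continuous_finsetSum _ fun i _ =>
    (conv _).continuous.comp (continuous_apply i)
  refine closure_mono ?_ (image_closure_subset_closure_image hc ⟨h, hd h, rfl⟩)
  rintro _ ⟨_, ⟨s, rfl⟩, rfl⟩
  exact hessConv_toLp_mem_range Q s

/-- Curl-freeness turns `∑ ∂_j ∂_i Q ∗ h_i` into `ΔQ ∗ h_j`, and the Laplacian of `Q` is `k₁ - k₂`.
-/
theorem hessConv_of_mem_curlFree {h : Fin d → (Rd d →₁[volume] ℂ)} (hh : h ∈ curlFree d)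
    {Q k₁ k₂ : 𝓢(Rd d, ℂ)} (hQ : ∀ ξ, (∑ i, derivSymbol i ξ * derivSymbol i ξ) * 𝓕 Q ξ =
      𝓕 k₁ ξ - 𝓕 k₂ ξ) (j : Fin d) :
    hessConv Q h j = conv (k₁.toLp 1) (h j) - conv (k₂.toLp 1) (h j) := by
  refine fourierAt_injective fun ξ => ?_
  simp only [hessConv, map_sum, map_sub, fourierAt_conv, fourierAt_toLp, fourier_lineDerivOp_apply]
  rw [← sub_mul, ← hQ, Finset.sum_mul, Finset.sum_mul]
  refine Finset.sum_congr rfl fun i _ => ?_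
  linear_combination (-derivSymbol i ξ * 𝓕 Q ξ) * mem_curlFree.1 hh i j ξ

theorem mem_closure_range_schwartzGrad {h : Fin d → (Rd d →₁[volume] ℂ)} (hh : h ∈ curlFree d)
    (h0 : ∀ j, fourierAt 0 (h j) = 0) : h ∈ closure (Set.range (schwartzGrad d)) := by
  have hr : ∀ n : ℕ, (0 : ℝ) < (n : ℝ) + 1 := fun n => by positivity
  have hr' : ∀ n : ℕ, (0 : ℝ) < 1 / ((n : ℝ) + 1) := fun n => by positivity
  have hle : ∀ n : ℕ, 1 / ((n : ℝ) + 1) ≤ (n : ℝ) + 1 := fun n => by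
    rw [div_le_iff₀ (hr n)]
    nlinarith [n.cast_nonneg (α := ℝ)]
  -- The outer radius `n + 1` recovers `h`; the inner radius `1 / (n + 1)` contributes nothing in
  -- the limit because the means vanish.
  choose Q hQ using fun n => exists_fourier_laplacian_eq (d := d) (hr' n) (hr n) (hle n)
  have hlim : Tendsto (fun n j => conv ((lowPassKernel d (hr n)).toLp 1) (h j) -
      conv ((lowPassKernel d (hr' n)).toLp 1) (h j)) atTop (𝓝 h) := by
    refine tendsto_pi_nhds.2 fun j => ?_
    have h1 := tendsto_conv_lowPassKernel_atTop hr
      (tendsto_atTop_add_const_right _ 1 tendsto_natCast_atTop_atTop) (h j)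
    have h2 := tendsto_conv_lowPassKernel_zero hr' tendsto_one_div_add_atTop_nhds_zero_nat (h0 j)
    simpa using h1.sub h2
  refine isClosed_closure.mem_of_tendsto hlim (Eventually.of_forall fun n => ?_)
  have e : hessConv (Q n) h = _ := funext (hessConv_of_mem_curlFree hh (hQ n))
  exact e ▸ hessConv_mem_closure (Q n) h

/-- The integrals of the entries of a curl-free tuple of integrable functions. -/
def meanMap (d : ℕ) : curlFree d →L[ℂ] (Fin d → ℂ) :=
  ContinuousLinearMap.pi fun j =>
    (fourierAt 0).comp ((ContinuousLinearMap.proj j).comp (curlFree d).subtypeL)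

theorem schwartzGrad_mem_curlFree (f : 𝓢(Rd d, ℂ)) : schwartzGrad d f ∈ curlFree d := by
  refine mem_curlFree.2 fun i j ξ => ?_
  simp only [schwartzGrad_apply, fourierAt_toLp, fourier_lineDerivOp_apply]
  ring

/-- The gradient of a Schwartz function, as a curl-free tuple. -/
def schwartzGradCurlFree (d : ℕ) : 𝓢(Rd d, ℂ) →ₗ[ℂ] curlFree d :=
  (schwartzGrad d).codRestrict (curlFree d) schwartzGrad_mem_curlFree

theorem meanMap_schwartzGradCurlFree (f : 𝓢(Rd d, ℂ)) :
    meanMap d (schwartzGradCurlFree d f) = 0 := by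
  refine funext fun j => ?_
  change fourierAt 0 (schwartzGrad d f j) = 0
  rw [schwartzGrad_apply, fourierAt_toLp, fourier_lineDerivOp_apply]
  simp [derivSymbol]

theorem mem_closure_range_schwartzGradCurlFree {h : curlFree d} (hh : meanMap d h = 0) :
    h ∈ closure (Set.range (schwartzGradCurlFree d)) := by
  refine Metric.mem_closure_iff.2 fun r hr => ?_
  obtain ⟨_, ⟨f, rfl⟩, hf⟩ := Metric.mem_closure_iff.1
    (mem_closure_range_schwartzGrad h.2 fun j => congrFun hh j) r hr
  exact ⟨_, ⟨f, rfl⟩, hf⟩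

/-! ### Continuity of the inclusion of test functions into Schwartz functions. -/

theorem testToSchwartz_add (φ ψ : 𝓓((⊤ : Opens (Rd d)), ℝ)) :
    testToSchwartz (φ + ψ) = testToSchwartz φ + testToSchwartz ψ := by
  ext x
  simp [testToSchwartz_apply]

theorem testToSchwartz_smul (c : ℝ) (φ : 𝓓((⊤ : Opens (Rd d)), ℝ)) :
    testToSchwartz (c • φ) = c • testToSchwartz φ := by
  ext x
  simp [testToSchwartz_apply]

theorem seminorm_testToSchwartz_le {K : Compacts (Rd d)} {R : ℝ}
    (hK : ∀ x ∈ K, ‖x‖ ≤ R) (hR : 0 ≤ R) (k n : ℕ) (φ : 𝓓_{K}(Rd d, ℝ)) :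
    SchwartzMap.seminorm ℝ k n
        (testToSchwartz (TestFunction.ofSupportedIn (Ω := ⊤) (fun _ _ => trivial) φ)) ≤
      R ^ k * ContDiffMapSupportedIn.seminorm ℝ (Rd d) ℝ ⊤ K n φ := by
  refine SchwartzMap.seminorm_le_bound ℝ k n _
    (mul_nonneg (pow_nonneg hR k) (apply_nonneg _ _)) fun x => ?_
  have e : (testToSchwartz (TestFunction.ofSupportedIn (Ω := ⊤) (fun _ _ => trivial) φ) :
      Rd d → ℂ) = Complex.ofRealLI ∘ φ := rfl
  rw [e, LinearIsometry.norm_iteratedFDeriv_comp_left Complex.ofRealLI φ.contDiff.contDiffAt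
    (mod_cast le_top)]
  by_cases hx : x ∈ K
  · gcongr
    · exact hK x hx
    · exact ContDiffMapSupportedIn.norm_iteratedFDeriv_apply_le_seminorm_top ℝ
  · have : iteratedFDeriv ℝ n φ x = 0 := φ.iteratedFDeriv_zero_on_compl hx
    rw [this, norm_zero, mul_zero]
    exact mul_nonneg (pow_nonneg hR k) (apply_nonneg _ _)

/-- The inclusion of the real test functions into the Schwartz functions. -/
def testToSchwartzCLM (d : ℕ) : 𝓓((⊤ : Opens (Rd d)), ℝ) →L[ℝ] 𝓢(Rd d, ℂ) :=
  TestFunction.mkCLM ℝ testToSchwartz testToSchwartz_add testToSchwartz_smul fun K hK => by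
    obtain ⟨R, hR⟩ := K.isCompact.isBounded.exists_norm_le
    let A : 𝓓_{K}(Rd d, ℝ) →ₗ[ℝ] 𝓢(Rd d, ℂ) :=
      { toFun φ := testToSchwartz (TestFunction.ofSupportedIn hK φ)
        map_add' φ ψ := by
          exact testToSchwartz_add (TestFunction.ofSupportedIn hK φ) (TestFunction.ofSupportedIn hK ψ)
        map_smul' c φ := by
          exact testToSchwartz_smul c (TestFunction.ofSupportedIn hK φ) }
    refine WithSeminorms.continuous_of_isBounded
      (ContDiffMapSupportedIn.withSeminorms ℝ (Rd d) ℝ ⊤ K)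
      (schwartz_withSeminorms ℝ (Rd d) ℂ) A fun p =>
        -- The bound `R` may be negative when `K` is empty, hence the maximum with `0`.
        ⟨{p.2}, (⟨(max R 0) ^ p.1, by positivity⟩ : NNReal), fun φ => ?_⟩
    rw [Finset.sup_singleton]
    exact seminorm_testToSchwartz_le (fun x hx => (hR x hx).trans (le_max_left _ _))
      (le_max_right _ _) p.1 p.2 φ

/-! ### Potentials of curl-free fields. -/

/-- The function `(∑ i, ξ_i ĥ_i(ξ)) / (2πi |ξ|²)`, the Fourier transform of a potential of the
curl-free tuple `h` away from the origin. -/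
def potentialSymbol (h : Fin d → (Rd d →₁[volume] ℂ)) (ξ : Rd d) : ℂ :=
  (∑ i, derivSymbol i ξ * fourierAt ξ (h i)) / ∑ i, derivSymbol i ξ * derivSymbol i ξ

theorem potentialSymbol_add (h g : Fin d → (Rd d →₁[volume] ℂ)) (ξ : Rd d) :
    potentialSymbol (h + g) ξ = potentialSymbol h ξ + potentialSymbol g ξ := by
  simp only [potentialSymbol, Pi.add_apply, map_add, mul_add, Finset.sum_add_distrib, add_div]

theorem potentialSymbol_smul (c : ℂ) (h : Fin d → (Rd d →₁[volume] ℂ)) (ξ : Rd d) :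
    potentialSymbol (c • h) ξ = c * potentialSymbol h ξ := by
  simp only [potentialSymbol, Pi.smul_apply, map_smul, smul_eq_mul, mul_left_comm _ c,
    ← Finset.mul_sum, mul_div_assoc]

theorem continuous_fourierAt (g : Rd d →₁[volume] ℂ) : Continuous fun ξ => fourierAt ξ g :=
  continuous_fourier (L1.integrable_coeFn g)

theorem aestronglyMeasurable_potentialSymbol (h : Fin d → (Rd d →₁[volume] ℂ)) :
    AEStronglyMeasurable (potentialSymbol h) volume := by
  have h1 : Continuous fun ξ => ∑ i, derivSymbol i ξ * fourierAt ξ (h i) :=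
    continuous_finsetSum _ fun i _ => (continuous_derivSymbol i).mul (continuous_fourierAt _)
  have h2 : Continuous fun ξ : Rd d => ∑ i, derivSymbol i ξ * derivSymbol i ξ :=
    continuous_finsetSum _ fun i _ => (continuous_derivSymbol i).mul (continuous_derivSymbol i)
  exact (h1.measurable.div h2.measurable).aestronglyMeasurable

/-- The numerator is `O(‖ξ‖)` and the denominator is of order `‖ξ‖²`. In dimension one this bound is
not locally integrable, which is why test functions are corrected by `subBall`. -/
theorem norm_potentialSymbol_le (h : Fin d → (Rd d →₁[volume] ℂ)) (ξ : Rd d) :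
    ‖potentialSymbol h ξ‖ ≤ (∑ i, ‖h i‖) / ‖ξ‖ := by
  by_cases hξ : ξ = 0
  -- At the origin both sides are `0` by the convention for division by zero.
  · simp [potentialSymbol, hξ, derivSymbol]
  have hpos := norm_pos_iff.2 hξ
  have hπ : 1 ≤ 2 * Real.pi := by linarith [Real.pi_gt_three]
  rw [potentialSymbol, sum_derivSymbol_mul_self, norm_div, Complex.norm_real, neg_mul, norm_neg,
    Real.norm_of_nonneg (by positivity), div_le_div_iff₀ (by positivity) hpos]
  have h1 : ‖∑ i, derivSymbol i ξ * fourierAt ξ (h i)‖ ≤ 2 * Real.pi * ‖ξ‖ * ∑ i, ‖h i‖ := by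
    rw [Finset.mul_sum]
    refine (norm_sum_le _ _).trans (Finset.sum_le_sum fun i _ => ?_)
    rw [norm_mul, norm_derivSymbol]
    gcongr
    · exact PiLp.norm_apply_le ξ i
    · exact norm_fourierAt_le ξ (h i)
  calc _ ≤ 2 * Real.pi * ‖ξ‖ * (∑ i, ‖h i‖) * ‖ξ‖ := by gcongr
    _ = 2 * Real.pi * ((∑ i, ‖h i‖) * ‖ξ‖ ^ 2) := by ring
    _ ≤ (2 * Real.pi) ^ 2 * ((∑ i, ‖h i‖) * ‖ξ‖ ^ 2) := by
        gcongr
        nlinarith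
    _ = _ := by ring

theorem derivSymbol_mul_potentialSymbol {h : Fin d → (Rd d →₁[volume] ℂ)} (hh : h ∈ curlFree d)
    (j : Fin d) {ξ : Rd d} (hξ : ξ ≠ 0) :
    derivSymbol j ξ * potentialSymbol h ξ = fourierAt ξ (h j) := by
  have hne : ∑ i, derivSymbol i ξ * derivSymbol i ξ ≠ 0 := by
    rw [sum_derivSymbol_mul_self]
    have := norm_pos_iff.2 hξ
    have h2 : 0 < (2 * Real.pi) ^ 2 * ‖ξ‖ ^ 2 := by positivity
    exact_mod_cast (by linarith : -(2 * Real.pi) ^ 2 * ‖ξ‖ ^ 2 ≠ 0)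
  rw [potentialSymbol, mul_div_assoc', div_eq_iff hne, Finset.mul_sum, Finset.mul_sum]
  refine Finset.sum_congr rfl fun i _ => ?_
  linear_combination (-derivSymbol i ξ) * mem_curlFree.1 hh i j ξ

theorem norm_sub_le_seminorm_mul_norm (η : 𝓢(Rd d, ℂ)) (ξ : Rd d) :
    ‖η ξ - η 0‖ ≤ SchwartzMap.seminorm ℝ 0 1 η * ‖ξ‖ := by
  have h : ∀ x ∈ Set.univ, ‖fderiv ℝ η x‖ ≤ SchwartzMap.seminorm ℝ 0 1 η := by
    intro x _
    have := SchwartzMap.le_seminorm ℝ 0 1 η x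
    rwa [pow_zero, one_mul, norm_iteratedFDeriv_one] at this
  simpa using convex_univ.norm_image_sub_le_of_norm_fderiv_le
    (fun x _ => η.differentiableAt) h (Set.mem_univ 0) (Set.mem_univ ξ)

/-- The function `η - η(0) 1_B`, where `B` is the unit ball. -/
def subBall (η : 𝓢(Rd d, ℂ)) (ξ : Rd d) : ℂ :=
  η ξ - (Metric.ball (0 : Rd d) 1).indicator (fun _ => η 0) ξ

/-- Inside the ball the Lipschitz bound `‖η ξ - η 0‖ ≤ c ‖ξ‖` cancels the singularity; outside it
the symbol is bounded. The majorant is integrable and continuous in `η`. -/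
theorem norm_subBall_mul_potentialSymbol_le (h : Fin d → (Rd d →₁[volume] ℂ)) (η : 𝓢(Rd d, ℂ))
    (ξ : Rd d) :
    ‖subBall η ξ * potentialSymbol h ξ‖ ≤ (∑ i, ‖h i‖) *
      ((Metric.ball (0 : Rd d) 1).indicator (fun _ => SchwartzMap.seminorm ℝ 0 1 η) ξ + ‖η ξ‖) := by
  have hs : 0 ≤ SchwartzMap.seminorm ℝ 0 1 η := apply_nonneg _ _
  have hH : 0 ≤ ∑ i, ‖h i‖ := by positivity
  rw [norm_mul]
  by_cases hξ : ξ ∈ Metric.ball (0 : Rd d) 1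
  · rw [subBall, Set.indicator_of_mem hξ, Set.indicator_of_mem hξ]
    calc ‖η ξ - η 0‖ * ‖potentialSymbol h ξ‖
        ≤ (SchwartzMap.seminorm ℝ 0 1 η * ‖ξ‖) * ((∑ i, ‖h i‖) / ‖ξ‖) := by
          gcongr
          · exact norm_sub_le_seminorm_mul_norm η ξ
          · exact norm_potentialSymbol_le h ξ
      _ = (∑ i, ‖h i‖) * (SchwartzMap.seminorm ℝ 0 1 η * (‖ξ‖ / ‖ξ‖)) := by ring
      _ ≤ (∑ i, ‖h i‖) * (SchwartzMap.seminorm ℝ 0 1 η * 1) := by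
          gcongr
          exact div_self_le_one _
      _ ≤ _ := by
          gcongr
          rw [mul_one]
          exact le_add_of_nonneg_right (norm_nonneg _)
  · rw [subBall, Set.indicator_of_notMem hξ, Set.indicator_of_notMem hξ, sub_zero, zero_add,
      mul_comm]
    rw [mem_ball_zero_iff, not_lt] at hξ
    gcongr
    exact (norm_potentialSymbol_le h ξ).trans (div_le_self hH hξ)

theorem integrable_indicator_ball_const {F : Type*} [NormedAddCommGroup F] (c : F) :
    Integrable ((Metric.ball (0 : Rd d) 1).indicator fun _ => c) :=
  (integrable_indicator_iff Metric.isOpen_ball.measurableSet).2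
    (integrableOn_const Metric.isBounded_ball.measure_lt_top.ne)

theorem integrable_subBall (η : 𝓢(Rd d, ℂ)) : Integrable (subBall η) :=
  η.integrable.sub (integrable_indicator_ball_const _)

theorem integrable_subBall_mul_potentialSymbol (h : Fin d → (Rd d →₁[volume] ℂ))
    (η : 𝓢(Rd d, ℂ)) : Integrable fun ξ => subBall η ξ * potentialSymbol h ξ := by
  refine Integrable.mono' (((integrable_indicator_ball_const _).add η.integrable.norm).const_mul
    (∑ i, ‖h i‖)) ((integrable_subBall η).aestronglyMeasurable.mul
      (aestronglyMeasurable_potentialSymbol h))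
    (ae_of_all _ fun ξ => norm_subBall_mul_potentialSymbol_le h η ξ)

theorem subBall_add (η θ : 𝓢(Rd d, ℂ)) (ξ : Rd d) :
    subBall (η + θ) ξ = subBall η ξ + subBall θ ξ := by
  by_cases hξ : ξ ∈ Metric.ball (0 : Rd d) 1
  · simp only [subBall, Set.indicator_of_mem hξ, add_apply]
    ring
  · simp only [subBall, Set.indicator_of_notMem hξ, add_apply]
    ring

theorem subBall_smul (c : ℂ) (η : 𝓢(Rd d, ℂ)) (ξ : Rd d) :
    subBall (c • η) ξ = c * subBall η ξ := by
  by_cases hξ : ξ ∈ Metric.ball (0 : Rd d) 1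
  · simp only [subBall, Set.indicator_of_mem hξ, smul_apply, smul_eq_mul]
    ring
  · simp only [subBall, Set.indicator_of_notMem hξ, smul_apply, smul_eq_mul]
    ring

/-- The Fourier transform of a potential of a curl-free tuple `h`, as a functional on the Schwartz
functions. The behaviour of `potentialSymbol` at the origin is compensated by subtracting the value
at the origin, which amounts to a choice of the additive constant. -/
def potentialFunctional (h : Fin d → (Rd d →₁[volume] ℂ)) : 𝓢(Rd d, ℂ) →L[ℂ] ℂ where
  toFun η := ∫ ξ, subBall η ξ * potentialSymbol h ξ
  map_add' η θ := by
    simp only [subBall_add, add_mul]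
    exact integral_add (integrable_subBall_mul_potentialSymbol h η)
      (integrable_subBall_mul_potentialSymbol h θ)
  map_smul' c η := by
    simp only [subBall_smul, mul_assoc, RingHom.id_apply, smul_eq_mul]
    exact integral_const_mul c _
  cont := by
    let A : 𝓢(Rd d, ℂ) →+ ℂ :=
      { toFun η := ∫ ξ, subBall η ξ * potentialSymbol h ξ
        map_zero' := by simp [subBall]
        map_add' η θ := by
          simp only [subBall_add, add_mul]
          exact integral_add (integrable_subBall_mul_potentialSymbol h η)
            (integrable_subBall_mul_potentialSymbol h θ) }
    refine continuous_of_continuousAt_zero A ?_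
    rw [ContinuousAt, map_zero, tendsto_zero_iff_norm_tendsto_zero]
    have hcont : Continuous fun η : 𝓢(Rd d, ℂ) => (∑ i, ‖h i‖) *
        (volume.real (Metric.ball (0 : Rd d) 1) * SchwartzMap.seminorm ℝ 0 1 η +
          ‖SchwartzMap.toLpCLM ℝ ℂ 1 volume η‖) := by
      have h1 : Continuous fun η : 𝓢(Rd d, ℂ) => SchwartzMap.seminorm ℝ 0 1 η :=
        (schwartz_withSeminorms ℝ (Rd d) ℂ).continuous_seminorm (0, 1)
      fun_prop
    have hlim := hcont.tendsto 0
    simp only [map_zero, norm_zero, mul_zero, add_zero] at hlim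
    refine squeeze_zero (fun η => norm_nonneg _) (fun η => ?_) hlim
    refine (norm_integral_le_integral_norm _).trans ?_
    refine (integral_mono (integrable_subBall_mul_potentialSymbol h η).norm
      (((integrable_indicator_ball_const _).add η.integrable.norm).const_mul (∑ i, ‖h i‖))
      (norm_subBall_mul_potentialSymbol_le h η)).trans (le_of_eq ?_)
    simp only [Pi.add_apply]
    rw [integral_const_mul, integral_add (integrable_indicator_ball_const _) η.integrable.norm,
      integral_indicator_const _ Metric.isOpen_ball.measurableSet, smul_eq_mul,
      SchwartzMap.toLpCLM_apply, SchwartzMap.norm_toLp_one]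

/-- A distribution whose gradient is the curl-free tuple `h`. -/
def potential (h : Fin d → (Rd d →₁[volume] ℂ)) : Distr d :=
  ((potentialFunctional h).restrictScalars ℝ).comp
    (((FourierTransform.fourierInvCLM ℂ 𝓢(Rd d, ℂ)).restrictScalars ℝ).comp (testToSchwartzCLM d))

theorem potential_apply (h : Fin d → (Rd d →₁[volume] ℂ)) (φ : 𝓓((⊤ : Opens (Rd d)), ℝ)) :
    potential h φ = ∫ ξ, subBall (𝓕⁻ (testToSchwartz φ)) ξ * potentialSymbol h ξ := rfl

theorem potential_add (h g : Fin d → (Rd d →₁[volume] ℂ)) :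
    potential (h + g) = potential h + potential g := by
  ext φ
  change potential _ φ = potential _ φ + potential _ φ
  simp only [potential_apply, potentialSymbol_add, mul_add]
  exact integral_add (integrable_subBall_mul_potentialSymbol h _)
    (integrable_subBall_mul_potentialSymbol g _)

theorem potential_smul (c : ℂ) (h : Fin d → (Rd d →₁[volume] ℂ)) :
    potential (c • h) = c • potential h := by
  ext φ
  change potential _ φ = c • potential _ φ
  simp only [potential_apply, potentialSymbol_smul, mul_left_comm _ c, smul_eq_mul]
  exact integral_const_mul c _

/-- The map `potential` as a linear map. -/
def potentialLM (d : ℕ) : (Fin d → (Rd d →₁[volume] ℂ)) →ₗ[ℂ] Distr d where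
  toFun := potential
  map_add' := potential_add
  map_smul' := potential_smul

theorem ae_ne_zero (j : Fin d) : ∀ᵐ ξ : Rd d, ξ ≠ 0 := by
  have : NeZero d := ⟨fun h => by subst h; exact j.elim0⟩
  exact compl_mem_ae_iff.2 (measure_singleton 0)

theorem pderiv_potential {h : Fin d → (Rd d →₁[volume] ℂ)} (hh : h ∈ curlFree d) (j : Fin d) :
    pderiv j (potential h) = ofL1 d (h j) := by
  ext φ
  rw [pderiv_apply, potential_apply, testToSchwartz_lineDerivOp]
  have h1 : ∫ ξ, subBall (𝓕⁻ (∂_{stdVec j} (testToSchwartz φ) : 𝓢(Rd d, ℂ))) ξ *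
      potentialSymbol h ξ = -∫ ξ, 𝓕⁻ (testToSchwartz φ) ξ * 𝓕 (h j : Rd d → ℂ) ξ := by
    rw [← integral_neg]
    refine integral_congr_ae ?_
    filter_upwards [ae_ne_zero j] with ξ hξ
    -- A derivative has integral zero, so the correction at the origin disappears and the
    -- regularisation does not affect the gradient.
    have h0 : (𝓕⁻ (∂_{stdVec j} (testToSchwartz φ) : 𝓢(Rd d, ℂ)) : 𝓢(Rd d, ℂ)) 0 = 0 := by
      rw [fourierInv_lineDerivOp_apply]
      simp [derivSymbol]
    rw [subBall, h0, Set.indicator_zero, sub_zero, fourierInv_lineDerivOp_apply,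
      ← fourierAt_apply, ← derivSymbol_mul_potentialSymbol hh j hξ]
    ring
  rw [h1, neg_neg, ← integral_fourier_mul (𝓕⁻ (testToSchwartz φ)).integrable
    (L1.integrable_coeFn (h j)), ← SchwartzMap.fourier_coe,
    FourierTransform.fourier_fourierInv_eq]
  exact (ofFun_apply_eq_integral_mul (L1_locallyIntegrable (h j)) φ).symm

theorem potential_mem_w11 {h : Fin d → (Rd d →₁[volume] ℂ)} (hh : h ∈ curlFree d) :
    potential h ∈ w11 d :=
  (Submodule.mem_iInf _).2 fun j => ⟨h j, (pderiv_potential hh j).symm⟩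

/-- The potential of a curl-free tuple as an element of the homogeneous Sobolev space. -/
def potentialPre (d : ℕ) : curlFree d →ₗ[ℂ] PreW11 d :=
  ((potentialLM d).domRestrict (curlFree d)).codRestrict (w11 d) fun h => potential_mem_w11 h.2

theorem toDistr_potentialPre (h : curlFree d) :
    PreW11.toDistr d (potentialPre d h) = potential (h : Fin d → _) := rfl

theorem grad_potentialPre (h : curlFree d) (j : Fin d) :
    PreW11.grad j (potentialPre d h) = (h : Fin d → _) j := by
  apply ofL1_injective d
  rw [PreW11.ofL1_grad, toDistr_potentialPre, pderiv_potential h.2]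

/-- The class of the potential of a curl-free tuple in the homogeneous Sobolev space. -/
def potentialW (d : ℕ) : curlFree d →L[ℂ] W11 d :=
  LinearMap.mkContinuous ((constants d).mkQ ∘ₗ potentialPre d) d fun h => by
    refine (Submodule.Quotient.norm_mk_le _ _).trans ?_
    rw [PreW11.norm_def]
    simp only [grad_potentialPre]
    calc ∑ j : Fin d, ‖(h : Fin d → (Rd d →₁[volume] ℂ)) j‖ ≤ ∑ j : Fin d, ‖h‖ :=
          Finset.sum_le_sum fun j _ => norm_le_pi_norm (h : Fin d → (Rd d →₁[volume] ℂ)) j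
      _ = d * ‖h‖ := by simp

theorem potentialW_apply (h : curlFree d) :
    potentialW d h = Submodule.Quotient.mk (potentialPre d h) := rfl

/-- Here the symbol equals `g` almost everywhere. As `g` is integrable, the two terms of `subBall`
can be integrated separately, and the correction pairs to `η 0 = ∫ φ` times the integral of `g` over
the ball, that is, a constant distribution. -/
theorem potential_eq_sub [NeZero d] {h : Fin d → (Rd d →₁[volume] ℂ)} (hh : h ∈ curlFree d)
    {g : Rd d → ℂ} (hg : Integrable g) (hg' : ∀ j, Integrable fun ξ => derivSymbol j ξ * g ξ)
    (hhg : ∀ j, h j =ᵐ[volume] 𝓕⁻ fun ξ => derivSymbol j ξ * g ξ) :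
    potential h = ofFun (𝓕⁻ g) -
      (∫ ξ in Metric.ball (0 : Rd d) 1, g ξ) • ofFun (fun _ : Rd d => (1 : ℂ)) := by
  have hsymb : potentialSymbol h =ᵐ[volume] g := by
    filter_upwards [ae_ne_zero (0 : Fin d), ae_all_iff.2 fun j => fourier_ae_eq_of_ae_eq_fourierInv
      (L1.integrable_coeFn (h j)) (hg' j) (hhg j)] with ξ hξ hF
    obtain ⟨j, hj⟩ : ∃ j, ξ j ≠ 0 := by
      by_contra! hc
      exact hξ (PiLp.ext hc)
    have hs : derivSymbol j ξ ≠ 0 := by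
      rw [← norm_ne_zero_iff, norm_derivSymbol]
      have := abs_pos.2 hj
      positivity
    refine mul_left_cancel₀ hs ?_
    rw [derivSymbol_mul_potentialSymbol hh j hξ, fourierAt_apply, hF]
  ext φ
  change potential h φ = ofFun (𝓕⁻ g) φ -
    (∫ ξ in Metric.ball (0 : Rd d) 1, g ξ) * ofFun (fun _ : Rd d => (1 : ℂ)) φ
  set η : 𝓢(Rd d, ℂ) := 𝓕⁻ (testToSchwartz φ) with hη
  have h0 : ofFun (fun _ : Rd d => (1 : ℂ)) φ = η 0 := by
    rw [ofFun_apply_eq_integral_mul continuous_const.locallyIntegrable, hη,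
      SchwartzMap.fourierInv_coe, Real.fourierInv_eq_fourier_neg, neg_zero, fourier_zero]
    simp
  have hI : Integrable fun ξ => (Metric.ball (0 : Rd d) 1).indicator (fun _ => η 0) ξ * g ξ := by
    have : (fun ξ => (Metric.ball (0 : Rd d) 1).indicator (fun _ => η 0) ξ * g ξ) =
        (Metric.ball (0 : Rd d) 1).indicator fun ξ => η 0 * g ξ := by
      ext ξ
      rw [Set.indicator_mul_left]
    rw [this]
    exact (hg.const_mul _).indicator Metric.isOpen_ball.measurableSet
  have h2 : ∫ ξ, (Metric.ball (0 : Rd d) 1).indicator (fun _ => η 0) ξ * g ξ =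
      (∫ ξ in Metric.ball (0 : Rd d) 1, g ξ) * η 0 := by
    simp only [← Set.indicator_mul_left]
    rw [integral_indicator Metric.isOpen_ball.measurableSet, integral_const_mul, mul_comm]
  rw [potential_apply, ofFun_fourierInv_apply hg, h0, ← h2, ← hη,
    ← integral_sub (integrable_schwartz_mul hg η) hI]
  refine integral_congr_ae ?_
  filter_upwards [hsymb] with ξ hξ
  rw [hξ, subBall, sub_mul]

/-! ### The limit operator. -/

theorem eq_of_ae_fourierAt_eq {f g : Rd d →₁[volume] ℂ}
    (h : ∀ᵐ ξ, fourierAt ξ f = fourierAt ξ g) : f = g :=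
  fourierAt_injective fun ξ => congrFun
    ((Continuous.ae_eq_iff_eq volume (continuous_fourierAt f) (continuous_fourierAt g)).1 h) ξ

theorem exists_limit_operator [NeZero d] {m : ℕ → Rd d → ℂ} {m₀ : Rd d → ℂ}
    {T : ℕ → (W11 d →L[ℂ] W11 d)} (hT : ∀ k, IsMultiplierWith (m k) (T k)) {C : ℝ}
    (hC : ∀ k, ‖T k‖ ≤ C) (hlim : ∀ ξ, Tendsto (fun k => m k ξ) atTop (𝓝 (m₀ ξ))) :
    ∃ B : 𝓢(Rd d, ℂ) →ₗ[ℂ] curlFree d,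
      (∀ f j, (B f : Fin d → (Rd d →₁[volume] ℂ)) j =ᵐ[volume]
        𝓕⁻ fun ξ => m₀ ξ * 𝓕 (∂_{stdVec j} f : 𝓢(Rd d, ℂ)) ξ) ∧
      ∀ f, ‖B f‖ ≤ C * d * ‖schwartzGrad d f‖ := by
  choose g hg hgn using exists_limit_grad hT hC hlim
  have hm₀ := memLp_top_of_tendsto hT hC hlim
  have hgF : ∀ f j, ∀ᵐ ξ, fourierAt ξ (g f j) = m₀ ξ * 𝓕 (∂_{stdVec j} f : 𝓢(Rd d, ℂ)) ξ :=
    fun f j => fourier_ae_eq_of_ae_eq_fourierInv (L1.integrable_coeFn _)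
      (integrable_mul_schwartz hm₀ _) (hg f j)
  -- The chosen `g f j` depend linearly on `f` because their Fourier transforms are prescribed
  -- almost everywhere.
  let A : 𝓢(Rd d, ℂ) →ₗ[ℂ] (Fin d → (Rd d →₁[volume] ℂ)) :=
    { toFun := g
      map_add' f f' := funext fun j => eq_of_ae_fourierAt_eq <| by
        filter_upwards [hgF f j, hgF f' j, hgF (f + f') j] with ξ h1 h2 h3
        rw [Pi.add_apply, map_add, h1, h2, h3]
        simp only [fourier_lineDerivOp_apply, FourierTransform.fourier_add, add_apply]
        ring
      map_smul' c f := funext fun j => eq_of_ae_fourierAt_eq <| by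
        filter_upwards [hgF f j, hgF (c • f) j] with ξ h1 h2
        rw [RingHom.id_apply, Pi.smul_apply, map_smul, h1, h2]
        simp only [fourier_lineDerivOp_apply, FourierTransform.fourier_smul, smul_apply,
          smul_eq_mul]
        ring }
  have hA : ∀ f, A f ∈ curlFree d := by
    intro f
    refine mem_curlFree.2 fun i j ξ => ?_
    refine congrFun ((Continuous.ae_eq_iff_eq volume
      ((continuous_derivSymbol i).mul (continuous_fourierAt (g f j)))
      ((continuous_derivSymbol j).mul (continuous_fourierAt (g f i)))).1 ?_) ξ
    filter_upwards [hgF f i, hgF f j] with ξ h1 h2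
    rw [Pi.mul_apply, Pi.mul_apply, h1, h2, fourier_lineDerivOp_apply, fourier_lineDerivOp_apply]
    ring
  have hC0 : 0 ≤ C := (ContinuousLinearMap.opNorm_nonneg _).trans (hC 0)
  refine ⟨A.codRestrict (curlFree d) hA, hg, fun f => ?_⟩
  refine (pi_norm_le_iff_of_nonneg (by positivity)).2 fun j => ?_
  rw [mul_assoc]
  exact hgn f j

/-- The image of `e` is dense only in the kernel of `L`. As `L` has finite-dimensional range, this
kernel is the image of a bounded projection; extend `B` to the kernel by density and precompose with
the projection. -/
theorem exists_continuous_extension {V X F M : Type*} [AddCommGroup V] [Module ℂ V]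
    [NormedAddCommGroup X] [NormedSpace ℂ X] [NormedAddCommGroup F] [NormedSpace ℂ F]
    [CompleteSpace F] [NormedAddCommGroup M] [NormedSpace ℂ M] [FiniteDimensional ℂ M]
    (L : X →L[ℂ] M) (e : V →ₗ[ℂ] X) (B : V →ₗ[ℂ] F) (hL : ∀ v, L (e v) = 0)
    (he : ∀ x, L x = 0 → x ∈ closure (Set.range e)) {C : ℝ} (hB : ∀ v, ‖B v‖ ≤ C * ‖e v‖) :
    ∃ S : X →L[ℂ] F, ∀ v, S (e v) = B v := by
  let e' : V →ₗ[ℂ] L.toLinearMap.ker := e.codRestrict _ hL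
  have hd : DenseRange e' := by
    refine Metric.denseRange_iff.2 fun x r hr => ?_
    obtain ⟨_, ⟨v, rfl⟩, hv⟩ := Metric.mem_closure_iff.1 (he x x.2) r hr
    exact ⟨v, hv⟩
  obtain ⟨P, hP⟩ := L.ker_closedComplemented_of_finiteDimensional_range
  refine ⟨(B.extendOfNorm e').comp P, fun v => ?_⟩
  rw [ContinuousLinearMap.comp_apply, show e v = (e' v : X) from rfl, hP]
  exact LinearMap.extendOfNorm_eq hd ⟨C, hB⟩ v

theorem exists_operator_ofSchwartz (B : 𝓢(Rd d, ℂ) →ₗ[ℂ] curlFree d) {C : ℝ}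
    (hB : ∀ f, ‖B f‖ ≤ C * ‖schwartzGrad d f‖) :
    ∃ T : W11 d →L[ℂ] W11 d, ∀ f,
      T (ofSchwartz f) = Submodule.Quotient.mk (potentialPre d (B f)) := by
  obtain ⟨S, hS⟩ := exists_continuous_extension (meanMap d) (schwartzGradCurlFree d) B
    meanMap_schwartzGradCurlFree (fun _ h => mem_closure_range_schwartzGradCurlFree h) hB
  refine ⟨(potentialW d).comp (S.comp (gradient d)), fun f => ?_⟩
  have hgrad : gradient d (ofSchwartz f) = schwartzGradCurlFree d f :=
    Subtype.ext (funext fun j => gradW_ofSchwartz f j)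
  rw [ContinuousLinearMap.comp_apply, ContinuousLinearMap.comp_apply, hgrad, hS, potentialW_apply]

theorem isMultiplier_of_neZero [NeZero d] {m : ℕ → Rd d → ℂ} {m₀ : Rd d → ℂ}
    {T : ℕ → (W11 d →L[ℂ] W11 d)} (hT : ∀ k, IsMultiplierWith (m k) (T k)) {C : ℝ}
    (hC : ∀ k, ‖T k‖ ≤ C) (hlim : ∀ ξ, Tendsto (fun k => m k ξ) atTop (𝓝 (m₀ ξ))) :
    IsMultiplier m₀ := by
  have hm₀ := memLp_top_of_tendsto hT hC hlim
  obtain ⟨B, hB, hBn⟩ := exists_limit_operator hT hC hlim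
  obtain ⟨T₀, hT₀⟩ := exists_operator_ofSchwartz B hBn
  refine ⟨T₀, hm₀, fun f => ?_⟩
  have hg := integrable_mul_schwartz hm₀ (𝓕 f)
  have hg' : ∀ j, Integrable fun ξ => derivSymbol j ξ * (m₀ ξ * 𝓕 f ξ) := by
    intro j
    rw [derivSymbol_mul_mul_fourier]
    exact integrable_mul_schwartz hm₀ _
  have hpot := potential_eq_sub (B f).2 hg hg' fun j => by
    rw [derivSymbol_mul_mul_fourier]
    exact hB f j
  -- The potential has the right class but its transform may carry an extra mass at the origin, so
  -- the representative is changed by a constant to `𝓕⁻ (m₀ * 𝓕 f)`.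
  have hmem : ofFun (𝓕⁻ fun ξ => m₀ ξ * 𝓕 f ξ) ∈ w11 d := by
    refine (Submodule.mem_iInf _).2 fun j => ⟨(B f : Fin d → _) j, ?_⟩
    have h1 := pderiv_potential (B f).2 j
    rw [hpot, map_sub, map_smul, pderiv_ofFun_one] at h1
    rw [← h1]
    ext φ
    simp
  obtain ⟨v, hv, hv'⟩ := exists_isRestriction_isGivenBy hg
  let u : PreW11 d := ⟨_, hmem⟩
  have hu : PreW11.toDistr d u = ofFun (𝓕⁻ fun ξ => m₀ ξ * 𝓕 f ξ) := rfl
  refine ⟨u, v, (hT₀ f).trans ?_, hv, hv'⟩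
  refine (Submodule.Quotient.eq (constants d)).2 (Submodule.mem_comap.2 ?_)
  refine Submodule.mem_span_singleton.2 ⟨-∫ ξ in Metric.ball (0 : Rd d) 1, m₀ ξ * 𝓕 f ξ, ?_⟩
  rw [map_sub, toDistr_potentialPre, hpot, hu]
  ext φ
  simp

/-- The underlying space is a point, so every function is constant and the zero operator works. -/
theorem isMultiplier_zero_dim (m : Rd 0 → ℂ) : IsMultiplier m := by
  have hm : MemLp m ∞ volume :=
    memLp_top_of_bound (Continuous.aestronglyMeasurable continuous_of_discreteTopology) ‖m 0‖
      (ae_of_all _ fun ξ => by rw [Subsingleton.elim ξ 0])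
  refine ⟨0, hm, fun f => ?_⟩
  have hmem : ofFun (𝓕⁻ fun ξ => m ξ * 𝓕 f ξ) ∈ w11 0 :=
    (Submodule.mem_iInf _).2 fun j => j.elim0
  obtain ⟨v, hv, hv'⟩ := exists_isRestriction_isGivenBy (integrable_mul_schwartz hm (𝓕 f))
  refine ⟨(⟨_, hmem⟩ : w11 0), v, ?_, hv, hv'⟩
  refine ((Submodule.Quotient.mk_eq_zero (constants 0)).2 (Submodule.mem_comap.2 ?_)).symm
  refine Submodule.mem_span_singleton.2 ⟨𝓕⁻ (fun ξ => m ξ * 𝓕 f ξ) 0, ?_⟩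
  change _ = ofFun (𝓕⁻ fun ξ => m ξ * 𝓕 f ξ)
  have e : (𝓕⁻ fun ξ => m ξ * 𝓕 f ξ) = fun _ => 𝓕⁻ (fun ξ => m ξ * 𝓕 f ξ) 0 :=
    funext fun x => by rw [Subsingleton.elim x 0]
  rw [e]
  ext φ
  change (_ : ℂ) • ofFun _ φ = ofFun _ φ
  rw [ofFun_apply continuous_const.locallyIntegrable,
    ofFun_apply continuous_const.locallyIntegrable, ← integral_smul]
  congr with x
  simp [mul_comm]

end HomSobolev

end

theorem mainTheorem2 {d : ℕ}
    (m : ℕ → HomSobolev.Rd d → ℂ) (m₀ : HomSobolev.Rd d → ℂ)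
    (T : ℕ → (HomSobolev.W11 d →L[ℂ] HomSobolev.W11 d))
    (hT : ∀ k, HomSobolev.IsMultiplierWith (m k) (T k))
    (hbdd : ∃ C : ℝ, ∀ k, ‖T k‖ ≤ C)
    (hlim : ∀ ξ, Filter.Tendsto (fun k => m k ξ) Filter.atTop (nhds (m₀ ξ)))
    (hcont : ∀ j : Fin d, Continuous (fun ξ : HomSobolev.Rd d => m₀ ξ * ((ξ j : ℝ) : ℂ))) :
    HomSobolev.IsMultiplier m₀ := by
  obtain ⟨C, hC⟩ := hbdd
  rcases Nat.eq_zero_or_pos d with rfl | hd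
  · exact HomSobolev.isMultiplier_zero_dim m₀
  · have : NeZero d := ⟨hd.ne'⟩
    exact HomSobolev.isMultiplier_of_neZero hT hC hlim
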